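/- Let $k\ge 1$ and let $NC_2(2k)$ be the set of non-crossing pair partitions of $\{1,\dots,2k\}$. For $d\in\mathbb C$ let $\mathrm{TL}_k(d)$ be the Temperley--Lieb algebra realised on the complex vector space with basis the Temperley--Lieb diagrams $D_p$, $p\in NC_2(2k)$ (the points $1,\dots,k$ on the top edge of a square and $k+1,\dots,2k$ on the bottom edge, placed clockwise and joined by non-crossing strands according to $p$), with product $D_pD_q=d^{c}D_r$, where $D_q$ is stacked on top of $D_p$, $c$ is the number of closed loops that arise, and $D_r$ is the diagram left after removing them. Let $\mathrm{Tr}$ be the Markov trace, $\mathrm{Tr}(D_p)=d^{\#\mathrm{loops}}$, where the loops are those obtained by joining, for each $j$, the $j$-th top point of $D_p$ to its $j$-th bottom point, and let $\langle x,y\rangle=\mathrm{Tr}(x^{t}y)$, where $x\mapsto x^t$ is the linear map that turns diagrams upside down. When this form is non-degenerate, let $\{\hat D_p\}$ be the dual basis of $\{D_p\}$, so that $\langle D_p,\hat D_q\rangle=\delta_{p,q}$, and write $\hat D_p=\sum_{q\in NC_2(2k)}\mathrm{Wg}_d(p,q)D_q$. A Jones--Wenzl projection is a non-zero idempotent $q_k\in\mathrm{TL}_k(d)$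 with $u_iq_k=q_ku_i=0$ for $1\le i\le k-1$, where $u_1,\dots,u_{k-1}$ are the standard generators: $u_i$ is the diagram that joins the $i$-th and $(i+1)$-th top points, joins the $i$-th and $(i+1)$-th bottom points, and joins every other top point to the bottom point straight below it. Then the following hold. 1. The form is non-degenerate for all but finitely many $d\in\mathbb C$, and for all $p,q\in NC_2(2k)$ one has $\mathrm{Wg}_d(p,q)=0$ for at most finitely many $d\in\mathbb C$. 2. If $d\in\mathbb R\setminus\left[-2\cos\left(\frac{\pi}{k+1}\right),2\cos\left(\frac{\pi}{k+1}\right)\right]$, then the form is non-degenerate and $\mathrm{Wg}_d(p,q)\neq0$ for all $p,q\in NC_2(2k)$. 3. There is $R$, depending only on $k$, such that for every $d\in\mathbb C$ with $|d|>R$ the form is non-degenerate and $\mathrm{Wg}_d(p,q)\ne 0$ for all $p,q\in NC_2(2k)$. In particular, for all $d$ as in 2 and 3, and for all but finitely many $d\in\mathbb C$, there is exactly one Jones--Wenzl projection in $\mathrm{TL}_k(d)$, and every diagram $D_p$, $p\in NC_2(2k)$, has a non-zero coefficient in it. -/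

import Mathlib

namespace TemperleyLieb

/-! ### Non-crossing pair partitions -/

/-- `NC2 k` is the set of non-crossing pair partitions of the ordered set of `2k` points, here
`0 < 1 < ... < 2k - 1`. A pair partition is given by the map that sends a point to the other
element of its block, that is, by a fixed-point-free involution; it is non-crossing if no two
blocks `{a, c}`, `{b, d}` satisfy `a < b < c < d`. -/
def NC2 (k : ℕ) : Type :=
  {p : Fin (2 * k) → Fin (2 * k) //
    (∀ i, p (p i) = i) ∧ (∀ i, p i ≠ i) ∧
      ∀ a b c d, a < b → b < c → c < d → p a = c → p b ≠ d}

instance (k : ℕ) : Fintype (NC2 k) := by unfold NC2; infer_instance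

instance (k : ℕ) : DecidableEq (NC2 k) := by unfold NC2; infer_instance

/-! ### Pictures

The `2k` points are placed clockwise on the boundary of a square: the points `0, ..., k - 1` are on
the top edge from left to right, and `k, ..., 2k - 1` are on the bottom edge from right to left.
So the point straight below (or above) the point `i` is the point `i.rev = 2k - 1 - i`. -/

/-- The diagram of `p` turned upside down. -/
def flip {k : ℕ} (p : NC2 k) : NC2 k :=
  ⟨fun i => (p.1 i.rev).rev, by
    obtain ⟨p, h1, h2, h3⟩ := p
    refine ⟨fun i => by simp [h1], fun i h => h2 i.rev ?_, ?_⟩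
    · simpa using congrArg Fin.rev h
    · intro a b c d hab hbc hcd hac hbd
      have hac' : p a.rev = c.rev := by simpa using congrArg Fin.rev hac
      have hbd' : p b.rev = d.rev := by simpa using congrArg Fin.rev hbd
      refine h3 d.rev c.rev b.rev a.rev (Fin.rev_lt_rev.2 hcd) (Fin.rev_lt_rev.2 hbc)
        (Fin.rev_lt_rev.2 hab) ?_ ?_
      · rw [← hbd', h1]
      · rw [← hac', h1]⟩

/-- The strands of the tracial closure of the diagram of `p`: each point is joined to its partner
in `p`, and the `j`-th point on the top is joined to the `j`-th point on the bottom. -/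
def closureRel {k : ℕ} (p : NC2 k) : Fin (2 * k) → Fin (2 * k) → Prop :=
  fun i j => j = p.1 i ∨ j = i.rev

/-- The number of loops of the tracial closure of the diagram of `p`, that is, the number of
connected components (`Quot` is the quotient by the equivalence relation that is generated by
the given relation). -/
noncomputable def closureLoops {k : ℕ} (p : NC2 k) : ℕ := Nat.card (Quot (closureRel p))

/-- The strands in the picture that has the diagram of `q` on top of the diagram of `p`.
The points `Sum.inl i` are those of `q` and the points `Sum.inr i` are those of `p`. For each
`j < k`, the `j`-th point on the top of `p` is joined to the `j`-th point on the bottom of `q`. -/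
def stackRel {k : ℕ} (p q : NC2 k) : Fin (2 * k) ⊕ Fin (2 * k) → Fin (2 * k) ⊕ Fin (2 * k) → Prop
  | Sum.inl i, Sum.inl j => j = q.1 i
  | Sum.inr i, Sum.inr j => j = p.1 i
  | Sum.inl i, Sum.inr j => j.val < k ∧ i = j.rev
  | Sum.inr _, Sum.inl _ => False

/-- The `2k` outer points of the stacked picture, in clockwise order: the top points of the upper
diagram and the bottom points of the lower one. -/
def outer (k : ℕ) (i : Fin (2 * k)) : Fin (2 * k) ⊕ Fin (2 * k) :=
  if i.val < k then Sum.inl i else Sum.inr i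

/-- The number of internal loops when the diagram of `q` is stacked on top of that of `p`, that is,
the number of connected components that contain no outer point. -/
noncomputable def stackLoops {k : ℕ} (p q : NC2 k) : ℕ :=
  Nat.card {c : Quot (stackRel p q) // ∀ i, Quot.mk (stackRel p q) (outer k i) ≠ c}

/-! Connecting the outer points of the stacked picture along its strands gives a non-crossing
pairing again. This is proved by gluing one pair of neighbouring points at a time. -/

/-- `f` is a fixed-point-free non-crossing involution of the subset `S` of the points, which are
ordered by their positions `pos`, and `f` joins the points of `S` that are connected by `R`. -/
def IsState {X : Type} (pos : X → ℕ) (R : X → X → Prop) (S : Set X) (f : X → X) : Prop :=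
  (∀ x ∈ S, f x ∈ S ∧ f (f x) = x ∧ f x ≠ x) ∧
  (∀ x ∈ S, ∀ y ∈ S, pos x < pos y → pos y < pos (f x) → pos (f x) < pos (f y) → False) ∧
  (∀ x ∈ S, ∀ y ∈ S, Relation.EqvGen R x y ↔ (x = y ∨ f x = y))

theorem eqvGen_glue {X : Type} (R : X → X → Prop) (a b x y : X) :
    Relation.EqvGen (fun u v => R u v ∨ (u = a ∧ v = b)) x y ↔
      Relation.EqvGen R x y ∨ (Relation.EqvGen R x a ∧ Relation.EqvGen R b y) ∨
        (Relation.EqvGen R x b ∧ Relation.EqvGen R a y) := by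
  have hr := fun x => Relation.EqvGen.refl (r := R) x
  have hs := fun x y h => Relation.EqvGen.symm (r := R) x y h
  have ht := fun x y z h h' => Relation.EqvGen.trans (r := R) x y z h h'
  constructor
  · intro h
    induction h with
    | rel u v h =>
      rcases h with h | ⟨rfl, rfl⟩
      · exact Or.inl (.rel _ _ h)
      · exact Or.inr (Or.inl ⟨hr _, hr _⟩)
    | refl u => exact Or.inl (hr _)
    | symm u v _ ih => grind
    | trans u v w _ _ ih1 ih2 => grind
  · have hm : ∀ u v, Relation.EqvGen R u v →
        Relation.EqvGen (fun u v => R u v ∨ (u = a ∧ v = b)) u v :=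
      fun u v h => Relation.EqvGen.mono (fun _ _ h => Or.inl h) _ _ h
    have hab : Relation.EqvGen (fun u v => R u v ∨ (u = a ∧ v = b)) a b :=
      .rel _ _ (Or.inr ⟨rfl, rfl⟩)
    rintro (h | ⟨h1, h2⟩ | ⟨h1, h2⟩)
    · exact hm _ _ h
    · exact (hm _ _ h1).trans _ _ _ (hab.trans _ _ _ (hm _ _ h2))
    · exact (hm _ _ h1).trans _ _ _ ((hab.symm _ _).trans _ _ _ (hm _ _ h2))

open Classical in
theorem IsState.glue {X : Type} {pos : X → ℕ} (hpos : Function.Injective pos)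
    {R : X → X → Prop} {S : Set X} {f : X → X} (h : IsState pos R S f) {a b : X}
    (ha : a ∈ S) (hb : b ∈ S) (hab : pos a < pos b)
    (hadj : ∀ x ∈ S, ¬ (pos a < pos x ∧ pos x < pos b)) :
    IsState pos (fun u v => R u v ∨ (u = a ∧ v = b)) {x ∈ S | x ≠ a ∧ x ≠ b}
      (fun x => if f x = a then f b else if f x = b then f a else f x) := by
  obtain ⟨h1, h2, h3⟩ := h
  have hne : a ≠ b := by rintro rfl; omega
  have key : ∀ x ∈ S, ∀ y ∈ S, pos x < pos y → pos y < pos (f x) →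
      pos x < pos (f y) ∧ pos (f y) < pos (f x) := by
    intro x hx y hy hxy hyf
    have hfy := h1 y hy
    have hfx := h1 x hx
    have e1 : pos (f y) ≠ pos x := fun e => by
      have := hpos e
      rw [← this, hfy.2.1] at hyf
      omega
    have e2 : pos (f y) ≠ pos (f x) := fun e => by
      have := congrArg f (hpos e)
      rw [hfy.2.1, hfx.2.1] at this
      subst this
      omega
    have n1 : ¬ pos (f x) < pos (f y) := h2 x hx y hy hxy hyf
    have n2 : ¬ pos (f y) < pos x := fun e =>
      h2 (f y) hfy.1 x hx e (by rwa [hfy.2.1]) (by rwa [hfy.2.1])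
    omega
  refine ⟨?_, ?_, ?_⟩
  · rintro x ⟨hx, hxa, hxb⟩
    have := h1 x hx
    have := h1 a ha
    have := h1 b hb
    simp only [Set.mem_ofPred_eq]
    grind
  · rintro x ⟨hx, hxa, hxb⟩ y ⟨hy, hya, hyb⟩
    have hfa := h1 a ha
    have hfb := h1 b hb
    have hfx := h1 x hx
    have hfy := h1 y hy
    have side : ∀ u ∈ S, ∀ z ∈ S, (pos u < pos z ∧ pos z < pos (f u)) →
        (pos u < pos (f z) ∧ pos (f z) < pos (f u)) := fun u hu z hz h => key u hu z hz h.1 h.2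
    have near : ∀ u ∈ S, u ≠ a → u ≠ b → (pos u < pos a ↔ pos u < pos b) := by
      intro u hu hua hub
      have := hadj u hu
      have h1 : pos u ≠ pos a := fun e => hua (hpos e)
      have h2 : pos u ≠ pos b := fun e => hub (hpos e)
      omega
    have near' : ∀ u ∈ S, u ≠ a → u ≠ b → (pos a < pos u ↔ pos b < pos u) := by
      intro u hu hua hub
      have := hadj u hu
      have h1 : pos u ≠ pos a := fun e => hua (hpos e)
      have h2 : pos u ≠ pos b := fun e => hub (hpos e)
      omega
    have inv : ∀ u ∈ S, ∀ v ∈ S, f u = f v → u = v := by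
      intro u hu v hv e
      rw [← (h1 u hu).2.1, e, (h1 v hv).2.1]
    have sxa := side x hx a ha
    have sxb := side x hx b hb
    have sxy := side x hx y hy
    have syx := side y hy x hx
    have sya := side y hy a ha
    have syb := side y hy b hb
    have sxa' := side x hx (f a) hfa.1
    have sxb' := side x hx (f b) hfb.1
    have sya' := side y hy (f a) hfa.1
    have syb' := side y hy (f b) hfb.1
    rw [hfa.2.1] at sxa' sya'
    rw [hfb.2.1] at sxb' syb'
    intro c1 c2 c3
    by_cases xa : f x = a
    · have ea : f a = x := by rw [← xa, hfx.2.1]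
      by_cases ya : f y = a
      · exact absurd (inv x hx y hy (xa.trans ya.symm)) (by rintro rfl; omega)
      by_cases yb : f y = b
      · have eb : f b = y := by rw [← yb, hfy.2.1]
        simp only [xa, yb, if_true, hne.symm, if_false, ea, eb] at c1 c2 c3
        omega
      · simp only [xa, ya, yb, if_true, if_false] at c1 c2 c3
        have n1 := near y hy hya hyb
        have n2 := near' (f y) hfy.1 ya yb
        rw [ea] at sya sya'
        omega
    by_cases xb : f x = b
    · have eb : f b = x := by rw [← xb, hfx.2.1]
      by_cases ya : f y = a
      · have ea : f a = y := by rw [← ya, hfy.2.1]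
        simp only [xb, ya, if_true, hne.symm, if_false, ea, eb] at c1 c2 c3
        omega
      by_cases yb : f y = b
      · exact absurd (inv x hx y hy (xb.trans yb.symm)) (by rintro rfl; omega)
      · simp only [xb, ya, yb, hne.symm, if_true, if_false] at c1 c2 c3
        have n1 := near y hy hya hyb
        have n2 := near' (f y) hfy.1 ya yb
        rw [eb] at syb syb'
        omega
    have m1 := near x hx hxa hxb
    have m2 := near' (f x) hfx.1 xa xb
    by_cases ya : f y = a
    · have ea : f a = y := by rw [← ya, hfy.2.1]
      simp only [xa, xb, ya, if_true, if_false] at c1 c2 c3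
      rw [ea] at sxa sxa'
      omega
    by_cases yb : f y = b
    · have eb : f b = y := by rw [← yb, hfy.2.1]
      simp only [xa, xb, yb, hne.symm, if_true, if_false] at c1 c2 c3
      rw [eb] at sxb sxb'
      omega
    simp only [xa, xb, ya, yb, if_false] at c1 c2 c3
    exact h2 x hx y hy c1 c2 c3
  · rintro x ⟨hx, hxa, hxb⟩ y ⟨hy, hya, hyb⟩
    rw [eqvGen_glue, h3 x hx y hy, h3 x hx a ha, h3 b hb y hy, h3 x hx b hb, h3 a ha y hy]
    have := h1 x hx
    have := h1 a ha
    have := h1 b hb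
    grind

/-- The points that are left after gluing the first `m` pairs of points. -/
def stackSet (k m : ℕ) : Set (Fin (2 * k) ⊕ Fin (2 * k)) :=
  {x | Sum.elim (fun i => i.val + m < 2 * k) (fun i => m ≤ i.val) x}

/-- The strands of the stacked picture when only the first `m` pairs of points are glued. -/
def stackRelAux {k : ℕ} (p q : NC2 k) (m : ℕ) :
    Fin (2 * k) ⊕ Fin (2 * k) → Fin (2 * k) ⊕ Fin (2 * k) → Prop
  | Sum.inl i, Sum.inl j => j = q.1 i
  | Sum.inr i, Sum.inr j => j = p.1 i
  | Sum.inl i, Sum.inr j => j.val < m ∧ i = j.rev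
  | Sum.inr _, Sum.inl _ => False

/-- The positions of the points of the stacked picture. -/
def stackPos (k : ℕ) : Fin (2 * k) ⊕ Fin (2 * k) → ℕ :=
  Sum.elim (fun i => i.val) (fun i => 2 * k + i.val)

theorem exists_isState {k : ℕ} (p q : NC2 k) (m : ℕ) (hm : m ≤ k) :
    ∃ f, IsState (stackPos k) (stackRelAux p q m) (stackSet k m) f := by
  induction m with
  | zero =>
    refine ⟨Sum.map q.1 p.1, ?_, ?_, ?_⟩
    · rintro (x | x) _
      · have := q.2.1 x
        have := q.2.2.1 x
        simp_all [stackSet]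
      · have := p.2.1 x
        have := p.2.2.1 x
        simp_all [stackSet]
    · rintro (x | x) _ (y | y) _ <;> simp only [stackPos, Sum.elim_inl, Sum.elim_inr, Sum.map_inl,
        Sum.map_inr] <;> intro h1 h2 h3
      · exact q.2.2.2 x y (q.1 x) (q.1 y) (by omega) (by omega) (by omega) rfl rfl
      · omega
      · omega
      · exact p.2.2.2 x y (p.1 x) (p.1 y) (by omega) (by omega) (by omega) rfl rfl
    · intro x _ y _
      constructor
      · intro h
        induction h with
        | rel u v h =>
          rcases u with u | u <;> rcases v with v | v <;> simp_all [stackRelAux]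
        | refl u => exact Or.inl rfl
        | symm u v _ ih =>
          have := q.2.1
          have := p.2.1
          rcases u with u | u <;> rcases v with v | v <;> simp_all [stackSet] <;> grind
        | trans u v w _ _ ih1 ih2 =>
          have := q.2.1
          have := p.2.1
          rcases u with u | u <;> rcases v with v | v <;> rcases w with w | w <;>
            simp_all [stackSet] <;> grind
      · rintro (rfl | rfl)
        · exact .refl _
        · refine .rel _ _ ?_
          rcases x with x | x <;> simp [stackRelAux]
  | succ m ih =>
    obtain ⟨f, hf⟩ := ih (by omega)
    have hpos : Function.Injective (stackPos k) := by
      rintro (x | x) (y | y) h <;> simp only [stackPos, Sum.elim_inl, Sum.elim_inr] at h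
      · rw [Fin.ext h]
      · omega
      · omega
      · rw [Fin.ext (by omega : x.val = y.val)]
    have hg := hf.glue hpos (a := Sum.inl (Fin.rev ⟨m, by omega⟩)) (b := Sum.inr ⟨m, by omega⟩)
      (by simp [stackSet, Fin.val_rev]; omega) (by simp [stackSet])
      (by simp [stackPos, Fin.val_rev]; omega)
      (by
        rintro (x | x) hx <;> simp [stackSet, stackPos, Fin.val_rev] at hx ⊢ <;> omega)
    have e1 : stackRelAux p q (m + 1) = fun u v => stackRelAux p q m u v ∨
        (u = Sum.inl (Fin.rev ⟨m, by omega⟩) ∧ v = Sum.inr ⟨m, by omega⟩) := by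
      funext x y
      rcases x with x | x <;> rcases y with y | y <;>
        simp [stackRelAux, Fin.ext_iff, Fin.val_rev]
      omega
    have e2 : stackSet k (m + 1) = {x ∈ stackSet k m |
        x ≠ Sum.inl (Fin.rev ⟨m, by omega⟩) ∧ x ≠ Sum.inr ⟨m, by omega⟩} := by
      ext x
      rcases x with x | x <;> simp [stackSet, Fin.ext_iff, Fin.val_rev] <;> omega
    rw [e1, e2]
    exact ⟨_, hg⟩

/-- There is exactly one non-crossing pairing that joins two different points if and only if they
are connected in the stacked picture. -/
theorem existsUnique_stack {k : ℕ} (p q : NC2 k) :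
    ∃! r : NC2 k, ∀ i j, i ≠ j → (r.1 i = j ↔
      Quot.mk (stackRel p q) (outer k i) = Quot.mk (stackRel p q) (outer k j)) := by
  obtain ⟨f, h1, h2, h3⟩ := exists_isState p q k le_rfl
  have hR : stackRelAux p q k = stackRel p q := by
    funext x y
    rcases x with x | x <;> rcases y with y | y <;> rfl
  rw [hR] at h3
  have ho : ∀ i, outer k i ∈ stackSet k k := by
    intro i
    unfold outer stackSet
    split_ifs <;> simp <;> omega
  let g : Fin (2 * k) ⊕ Fin (2 * k) → Fin (2 * k) := Sum.elim id id
  have hg : ∀ x ∈ stackSet k k, outer k (g x) = x := by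
    rintro (i | i) hi <;> simp [stackSet] at hi
    · exact if_pos (show i.val < k by omega)
    · exact if_neg (show ¬ i.val < k by omega)
  have hlt : ∀ i j, stackPos k (outer k i) < stackPos k (outer k j) ↔ i < j := by
    intro i j
    unfold outer stackPos
    split_ifs <;> simp <;> omega
  have hinj : Function.Injective (outer k) := by
    intro i j h
    have a := hlt i j
    have b := hlt j i
    rw [h] at a b
    have := lt_irrefl (stackPos k (outer k j))
    grind
  have hgf : ∀ i, outer k (g (f (outer k i))) = f (outer k i) := fun i => hg _ (h1 _ (ho i)).1
  refine ⟨⟨fun i => g (f (outer k i)), ?_, ?_, ?_⟩, ?_, ?_⟩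
  · intro i
    apply hinj
    rw [hgf, hgf, (h1 _ (ho i)).2.1]
  · intro i h
    have := congrArg (outer k) h
    rw [hgf] at this
    exact (h1 _ (ho i)).2.2 this
  · rintro a b c d hab hbc hcd rfl rfl
    refine h2 _ (ho a) _ (ho b) ((hlt _ _).2 hab) ?_ ?_
    · rw [← hgf, hlt]
      exact hbc
    · rw [← hgf, ← hgf b, hlt]
      exact hcd
  · intro i j hij
    rw [Quot.eq, h3 _ (ho i) _ (ho j), ← hgf]
    constructor
    · intro h
      exact Or.inr (congrArg _ h)
    · rintro (h | h)
      · exact absurd (hinj h) hij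
      · exact hinj h
  · intro r hr
    apply Subtype.ext
    funext i
    rw [hr i _ (fun h => ?_), Quot.eq, h3 _ (ho i) _ (ho _), hgf]
    · exact Or.inr rfl
    · have := congrArg (outer k) h
      rw [hgf] at this
      exact (h1 _ (ho i)).2.2 this.symm

/-- The non-crossing pairing of the diagram that is obtained by stacking the diagram of `q` on top
of the diagram of `p` and removing the internal loops: two different outer points are joined if and
only if they are connected in the stacked picture. -/
noncomputable def stack {k : ℕ} (p q : NC2 k) : NC2 k := (existsUnique_stack p q).choose

theorem stack_spec {k : ℕ} (p q : NC2 k) (i j : Fin (2 * k)) (hij : i ≠ j) :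
    (stack p q).1 i = j ↔
      Quot.mk (stackRel p q) (outer k i) = Quot.mk (stackRel p q) (outer k j) :=
  (existsUnique_stack p q).choose_spec.1 i j hij

/-- The pairing of the `i`-th standard generator (`i` runs from `0` to `k - 2` here): the points
`i`, `i + 1` on the top are joined, the points straight below them are joined, and every other point
on the top is joined to the point straight below it. -/
def generator {k : ℕ} (i : Fin (k - 1)) : NC2 k :=
  ⟨fun x =>
    if x.val = i.val then ⟨i.val + 1, by omega⟩
    else if x.val = i.val + 1 then ⟨i.val, by omega⟩
    else if x.rev.val = i.val then Fin.rev ⟨i.val + 1, by omega⟩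
    else if x.rev.val = i.val + 1 then Fin.rev ⟨i.val, by omega⟩
    else x.rev, by
    refine ⟨?_, ?_, ?_⟩
    · intro x
      simp only [Fin.ext_iff, Fin.val_rev]
      split_ifs <;> simp_all [Fin.val_rev] <;> omega
    · intro x
      simp only [ne_eq, Fin.ext_iff, Fin.val_rev]
      split_ifs <;> simp_all [Fin.val_rev] <;> omega
    · intro a b c d hab hbc hcd
      simp only [ne_eq, Fin.ext_iff, Fin.val_rev, Fin.lt_def] at *
      split_ifs <;> simp_all [Fin.val_rev] <;> omega⟩

/-! ### The Temperley-Lieb algebra -/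

/-- The Temperley-Lieb algebra with loop parameter `d`: the complex vector space spanned by the
diagrams `D_p`, `p ∈ NC2 k`, with the product `D_p D_q = d ^ c D_r`, where `c` is the number of
internal loops when `D_q` is stacked on top of `D_p`, and `D_r` is the remaining diagram. -/
def TL (k : ℕ) (_d : ℂ) : Type := NC2 k →₀ ℂ

noncomputable instance (k : ℕ) (d : ℂ) : AddCommGroup (TL k d) := by
  unfold TL; infer_instance

noncomputable instance (k : ℕ) (d : ℂ) : Module ℂ (TL k d) := by
  unfold TL; infer_instance

/-- The basis of the diagrams `D_p`. -/
noncomputable def diagramBasis (k : ℕ) (d : ℂ) : Module.Basis (NC2 k) ℂ (TL k d) :=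
  Module.Basis.ofRepr (LinearEquiv.refl ℂ (NC2 k →₀ ℂ))

/-- The product, as a bilinear map. -/
noncomputable def mulMap (k : ℕ) (d : ℂ) : TL k d →ₗ[ℂ] TL k d →ₗ[ℂ] TL k d :=
  (diagramBasis k d).constr ℂ fun p =>
    (diagramBasis k d).constr ℂ fun q => d ^ stackLoops p q • diagramBasis k d (stack p q)

noncomputable instance (k : ℕ) (d : ℂ) : Mul (TL k d) := ⟨fun x y => mulMap k d x y⟩

/-- The linear map that turns diagrams upside down. -/
noncomputable def transpose (k : ℕ) (d : ℂ) : TL k d →ₗ[ℂ] TL k d :=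
  (diagramBasis k d).constr ℂ fun p => diagramBasis k d (flip p)

/-- The Markov trace. -/
noncomputable def markovTrace (k : ℕ) (d : ℂ) : TL k d →ₗ[ℂ] ℂ :=
  (diagramBasis k d).constr ℂ fun p => d ^ closureLoops p

/-- The bilinear form `⟨x, y⟩ = Tr (xᵗ y)`. -/
noncomputable def form (k : ℕ) (d : ℂ) : LinearMap.BilinForm ℂ (TL k d) :=
  ((mulMap k d).compr₂ (markovTrace k d)).comp (transpose k d)

theorem form_apply {k : ℕ} {d : ℂ} (x y : TL k d) :
    form k d x y = markovTrace k d (transpose k d x * y) := rfl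

/-- The basis that is dual to the basis of diagrams, when the bilinear form is non-degenerate. -/
noncomputable def dualDiagram {k : ℕ} {d : ℂ} (h : (form k d).Nondegenerate) (p : NC2 k) :
    TL k d :=
  (form k d).dualBasis h (diagramBasis k d) p

/-- The coefficient of the diagram `D_q` in `x`. -/
noncomputable def coeff {k : ℕ} {d : ℂ} (x : TL k d) (q : NC2 k) : ℂ := (diagramBasis k d).repr x q

/-- The coefficient of `D_q` in the dual basis element that belongs to `D_p`. -/
noncomputable def Wg {k : ℕ} {d : ℂ} (h : (form k d).Nondegenerate) (p q : NC2 k) : ℂ :=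
  coeff (dualDiagram h p) q

/-- A Jones-Wenzl projection: a non-zero idempotent that is annihilated by the standard generators
from both sides. -/
def IsJonesWenzl {k : ℕ} {d : ℂ} (x : TL k d) : Prop :=
  x ≠ 0 ∧ x * x = x ∧
    ∀ i : Fin (k - 1),
      diagramBasis k d (generator i) * x = 0 ∧ x * diagramBasis k d (generator i) = 0

/-- There is exactly one Jones-Wenzl projection, and all its diagram coefficients are non-zero. -/
def JonesWenzlFull (k : ℕ) (d : ℂ) : Prop :=
  ∃ x : TL k d, IsJonesWenzl x ∧ (∀ y : TL k d, IsJonesWenzl y → y = x) ∧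
    ∀ q : NC2 k, coeff x q ≠ 0

end TemperleyLieb

namespace TemperleyLieb

/-! ### Counting connected components -/

/-! In the basis of diagrams the form is the matrix `d ^ loops p q`, and `Wg` is its inverse
(`form_diagram`, `Wg_eq_inv`). The core is `inv_gram_pos_of_lt`: for δ > 2cos(π/(k+1)) the matrix
`gram k δ` is invertible and its inverse is entrywise positive. For d = -δ this matrix is the form
up to a global sign. For d = δ it is the form after changing the signs of some basis vectors,
because the parity of the number of loops is governed by a product of signs (`neg_one_pow_loops`).

Positivity is proved by induction on the number of strands. A cup in one pairing can be moved to the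
other as a cap (`loops_cup`), so the inverse at level k yields `gram_relation`: δ x(cup i r) is the
sum of x over the other pairings with the same cap, plus a combination of values of Gx (G being the
Gram matrix at level k + 1) whose weights are entries of the inverse at level k. When those entries
are non-negative this behaves like a discrete superharmonicity condition: - for large δ, a maximum
principle makes the next inverse non-negative (`nonneg_of_gram_mulVec_nonneg`); - a Harnack
inequality (`le_mul_cup_cap`), with the transitivity of the cup-cap moves (`mem_of_closed`), turns
non-negative into positive (`inv_gram_pos`); - along the pairings `cup j (rainbow k)`, j ≤ k, the
relation is an inequality on a path with k + 1 vertices. The largest eigenvalue of that path is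
2cos(π/(k+2)), so entries of the inverse stay bounded above this value (`path_sum_le`,
`inv_gram_rainbow_le`). This is the source of the threshold. The parameters above the threshold with
a non-negative inverse therefore form an open, relatively closed and non-empty subset of a
half-line, hence all of it.

Non-vanishing of the determinant and of all cofactors is a polynomial condition on d, satisfied at d
= 3, so it fails only on a finite set, and a finite set is bounded. Finally, the dual of the
identity diagram, scaled to have identity coefficient 1, is the Jones-Wenzl projection
(`jonesWenzlFull_of_Wg_ne_zero`), so its coefficients are non-zero multiples of a row of `Wg`. -/

theorem eqvGen_involution {X : Type*} {f : X → X} (h : ∀ x, f (f x) = x) (x y : X) :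
    Relation.EqvGen (fun x y => y = f x) x y ↔ x = y ∨ f x = y := by
  constructor
  · intro h
    induction h with
    | rel u v h => exact Or.inr h.symm
    | refl u => exact Or.inl rfl
    | symm u v _ ih => grind
    | trans u v w _ _ ih1 ih2 => grind
  · rintro (rfl | rfl)
    · exact .refl _
    · exact .rel _ _ rfl

theorem card_quot_congr {X Y : Type*} {R : X → X → Prop} {S : Y → Y → Prop} (f : X → Y) (g : Y → X)
    (hf : ∀ x x', R x x' → Quot.mk S (f x) = Quot.mk S (f x'))
    (hg : ∀ y y', S y y' → Quot.mk R (g y) = Quot.mk R (g y'))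
    (hgf : ∀ x, Quot.mk R (g (f x)) = Quot.mk R x)
    (hfg : ∀ y, Quot.mk S (f (g y)) = Quot.mk S y) :
    Nat.card (Quot R) = Nat.card (Quot S) :=
  Nat.card_congr
    { toFun := Quot.lift (fun x => Quot.mk S (f x)) hf
      invFun := Quot.lift (fun y => Quot.mk R (g y)) hg
      left_inv := by rintro ⟨x⟩; exact hgf x
      right_inv := by rintro ⟨y⟩; exact hfg y }

open Classical in
/-- If points of a graph `R` are connected further by a graph `S` on a set `O` of outer points, then
the components are those of `R` that meet no outer point, and those of `S` together with the
connections `R'` that `R` induces on the outer points. -/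
theorem card_quot_outer {X O : Type*} [Finite X] [Finite O] (o : O → X) (R : X → X → Prop)
    (R' S : O → O → Prop)
    (h : ∀ i j, Quot.mk R' i = Quot.mk R' j ↔ Quot.mk R (o i) = Quot.mk R (o j)) :
    Nat.card (Quot fun x y => R x y ∨ ∃ i j, x = o i ∧ y = o j ∧ S i j) =
      Nat.card {c : Quot R // ∀ i, Quot.mk R (o i) ≠ c} +
        Nat.card (Quot fun i j => R' i j ∨ S i j) := by
  set T : X → X → Prop := fun x y => R x y ∨ ∃ i j, x = o i ∧ y = o j ∧ S i j with hT
  set T' : O → O → Prop := fun i j => R' i j ∨ S i j with hT'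
  have hRT : ∀ x y, Quot.mk R x = Quot.mk R y → Quot.mk T x = Quot.mk T y := fun x y e =>
    congrArg (Quot.lift (Quot.mk T) fun a b hab => Quot.sound (Or.inl hab)) e
  have hRT' : ∀ x y, Quot.mk R' x = Quot.mk R' y → Quot.mk T' x = Quot.mk T' y := fun x y e =>
    congrArg (Quot.lift (Quot.mk T') fun a b hab => Quot.sound (Or.inl hab)) e
  -- A component that meets the outer points is recorded by any outer point on it; by `h` the choice
  -- does not affect the class in `T'`.
  let F : X → {c : Quot R // ∀ i, Quot.mk R (o i) ≠ c} ⊕ Quot T' := fun x =>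
    if h : ∃ i, Quot.mk R (o i) = Quot.mk R x then Sum.inr (Quot.mk T' h.choose)
    else Sum.inl ⟨Quot.mk R x, fun i hi => h ⟨i, hi⟩⟩
  have hFo : ∀ i, F (o i) = Sum.inr (Quot.mk T' i) := by
    intro i
    have h1 : ∃ j, Quot.mk R (o j) = Quot.mk R (o i) := ⟨i, rfl⟩
    simp only [F, dif_pos h1, Sum.inr.injEq]
    exact hRT' _ _ ((h _ _).2 h1.choose_spec)
  have hFR : ∀ x y, R x y → F x = F y := by
    intro x y hxy
    have e : Quot.mk R x = Quot.mk R y := Quot.sound hxy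
    simp only [F, e]
  have hF : ∀ x y, T x y → F x = F y := by
    rintro x y (hxy | ⟨i, j, rfl, rfl, hij⟩)
    · exact hFR x y hxy
    · rw [hFo, hFo]
      exact congrArg _ (Quot.sound (Or.inr hij))
  have hG : ∀ i j, T' i j → Quot.mk T (o i) = Quot.mk T (o j) := by
    rintro i j (hij | hij)
    · exact hRT _ _ ((h i j).1 (Quot.sound hij))
    · exact Quot.sound (Or.inr ⟨i, j, rfl, rfl, hij⟩)
  have key : Quot T ≃ {c : Quot R // ∀ i, Quot.mk R (o i) ≠ c} ⊕ Quot T' :=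
    { toFun := Quot.lift F hF
      invFun := Sum.elim
        (fun c => Quot.lift (Quot.mk T) (fun a b hab => Quot.sound (Or.inl hab)) c.1)
        (Quot.lift (fun i => Quot.mk T (o i)) hG)
      left_inv := by
        rintro ⟨x⟩
        by_cases hx : ∃ i, Quot.mk R (o i) = Quot.mk R x
        · simp only [F, dif_pos hx, Sum.elim_inr]
          exact hRT _ _ hx.choose_spec
        · simp only [F, dif_neg hx, Sum.elim_inl]
      right_inv := by
        rintro (⟨⟨x⟩, hx⟩ | i)
        · have : ¬ ∃ i, Quot.mk R (o i) = Quot.mk R x := fun ⟨i, hi⟩ => hx i hi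
          simp only [Sum.elim_inl, F, dif_neg this]
        · induction i using Quot.ind with
          | mk i => exact hFo i }
  rw [Nat.card_congr key, Nat.card_sum]

/-- The number of closed loops that arise when the diagrams of two pairings of the same points are
glued along all the points. -/
noncomputable def loops {k : ℕ} (p q : NC2 k) : ℕ :=
  Nat.card (Quot fun i j => j = p.1 i ∨ j = q.1 i)

theorem loops_comm {k : ℕ} (p q : NC2 k) : loops p q = loops q p := by
  unfold loops
  simp only [or_comm]

theorem quot_mk_involution {X : Type*} {f : X → X} (h : ∀ x, f (f x) = x) (x y : X) :
    Quot.mk (fun x y => y = f x) x = Quot.mk (fun x y => y = f x) y ↔ x = y ∨ f x = y := by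
  rw [Quot.eq, eqvGen_involution h]

theorem stack_outer {k : ℕ} (p q : NC2 k) (i j : Fin (2 * k)) :
    Quot.mk (fun x y => y = (stack p q).1 x) i = Quot.mk (fun x y => y = (stack p q).1 x) j ↔
      Quot.mk (stackRel p q) (outer k i) = Quot.mk (stackRel p q) (outer k j) := by
  rw [quot_mk_involution (stack p q).2.1]
  by_cases hij : i = j
  · simp [hij]
  · simp [hij, stack_spec p q i j hij]

/-- The strands of the picture that has the diagram of `q` on top of the diagram of `p`, where the
outer points are joined further along `s`. -/
def closedRel {k : ℕ} (p q : NC2 k) (s : Fin (2 * k) → Fin (2 * k)) :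
    Fin (2 * k) ⊕ Fin (2 * k) → Fin (2 * k) ⊕ Fin (2 * k) → Prop :=
  fun x y => stackRel p q x y ∨ ∃ i j, x = outer k i ∧ y = outer k j ∧ j = s i

theorem card_closedRel {k : ℕ} (p q : NC2 k) (s : Fin (2 * k) → Fin (2 * k)) :
    Nat.card (Quot (closedRel p q s)) = stackLoops p q +
      Nat.card (Quot fun i j => j = (stack p q).1 i ∨ j = s i) :=
  card_quot_outer (outer k) (stackRel p q) _ (fun i j => j = s i) (stack_outer p q)

section closedRel

variable {k : ℕ} {p q : NC2 k} {s : Fin (2 * k) → Fin (2 * k)}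

theorem closedRel_inl (i : Fin (2 * k)) :
    Quot.mk (closedRel p q s) (Sum.inl i) = Quot.mk _ (Sum.inl (q.1 i)) :=
  Quot.sound (Or.inl rfl)

theorem closedRel_inr (i : Fin (2 * k)) :
    Quot.mk (closedRel p q s) (Sum.inr i) = Quot.mk _ (Sum.inr (p.1 i)) :=
  Quot.sound (Or.inl rfl)

theorem closedRel_glue (j : Fin (2 * k)) (hj : j.val < k) :
    Quot.mk (closedRel p q s) (Sum.inl j.rev) = Quot.mk _ (Sum.inr j) :=
  Quot.sound (Or.inl ⟨hj, rfl⟩)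

theorem closedRel_outer (i : Fin (2 * k)) :
    Quot.mk (closedRel p q s) (outer k i) = Quot.mk _ (outer k (s i)) :=
  Quot.sound (Or.inr ⟨i, _, rfl, rfl, rfl⟩)

/-- To define a map on the components of a closed picture, one has to check four kinds of
strands. -/
theorem closedRel_induction {Y : Type*} (F : Fin (2 * k) ⊕ Fin (2 * k) → Y)
    (h1 : ∀ i, F (Sum.inl i) = F (Sum.inl (q.1 i)))
    (h2 : ∀ i, F (Sum.inr i) = F (Sum.inr (p.1 i)))
    (h3 : ∀ j : Fin (2 * k), j.val < k → F (Sum.inl j.rev) = F (Sum.inr j))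
    (h4 : ∀ i, F (outer k i) = F (outer k (s i))) (x y : Fin (2 * k) ⊕ Fin (2 * k))
    (h : closedRel p q s x y) : F x = F y := by
  obtain h | ⟨i, j, rfl, rfl, rfl⟩ := h
  · rcases x with x | x <;> rcases y with y | y <;> simp only [stackRel] at h
    · rw [h, ← h1]
    · rw [h.2, h3 _ h.1]
    · rw [h, ← h2]
  · exact h4 i

end closedRel

/-! ### Loop counts of closed pictures and their symmetries. -/

theorem outer_of_lt {k : ℕ} {i : Fin (2 * k)} (h : i.val < k) : outer k i = Sum.inl i := if_pos h

theorem outer_of_le {k : ℕ} {i : Fin (2 * k)} (h : k ≤ i.val) : outer k i = Sum.inr i :=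
  if_neg (by omega)

theorem rev_lt_iff {k : ℕ} {i : Fin (2 * k)} : i.rev.val < k ↔ k ≤ i.val := by
  rw [Fin.val_rev]; omega

theorem le_rev_iff {k : ℕ} {i : Fin (2 * k)} : k ≤ i.rev.val ↔ i.val < k := by
  rw [Fin.val_rev]; omega

theorem flip_apply {k : ℕ} (p : NC2 k) (i : Fin (2 * k)) : (flip p).1 i = (p.1 i.rev).rev := rfl

/-- Stacking glues one half of the points and the closure the other half. Together they glue each
point of `q` to its mirror image in `flip p`, that is, to the same point of `p`. -/
theorem stackLoops_flip_add_closureLoops {k : ℕ} (p q : NC2 k) :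
    stackLoops (flip p) q + closureLoops (stack (flip p) q) = loops p q := by
  have h := card_closedRel (flip p) q Fin.rev
  rw [closureLoops, loops]
  unfold closureRel
  rw [← h]
  have glue : ∀ i, Quot.mk (closedRel (flip p) q Fin.rev) (Sum.inl i) =
      Quot.mk _ (Sum.inr i.rev) := by
    intro i
    rcases lt_or_ge i.val k with hi | hi
    · have := closedRel_outer (p := flip p) (q := q) (s := Fin.rev) i
      rwa [outer_of_lt hi, outer_of_le (le_rev_iff.2 hi)] at this
    · simpa using closedRel_glue (p := flip p) (q := q) (s := Fin.rev) i.rev (rev_lt_iff.2 hi)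
  refine card_quot_congr (Sum.elim id Fin.rev) Sum.inl ?_ ?_ ?_ ?_
  · refine closedRel_induction _ ?_ ?_ ?_ ?_
    · exact fun i => Quot.sound (Or.inr rfl)
    · exact fun i => Quot.sound (Or.inl (by simp [flip_apply]))
    · intro j _
      simp
    · intro i
      rcases lt_or_ge i.val k with hi | hi
      · rw [outer_of_lt hi, outer_of_le (le_rev_iff.2 hi)]
        simp
      · rw [outer_of_le hi, outer_of_lt (rev_lt_iff.2 hi)]
        simp
  · rintro i j (rfl | rfl)
    · rw [glue, glue, closedRel_inr, flip_apply]
      simp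
    · exact closedRel_inl i
  · rintro (i | i)
    · rfl
    · simp [glue]
  · intro i
    rfl

/-- Both sides count the loops of one closed picture made of three pairings, in which `t` and `y`
exchange roles when `q` is turned upside down. This is the combinatorial form of the adjointness of
left multiplication. -/
theorem stackLoops_add_loops_left {k : ℕ} (t q y : NC2 k) :
    stackLoops q y + loops (stack q y) t = stackLoops (flip q) t + loops (stack (flip q) t) y := by
  have h : ∀ t q y : NC2 k, stackLoops q y + loops (stack q y) t =
      Nat.card (Quot (closedRel q y t.1)) := fun t q y => (card_closedRel q y t.1).symm
  rw [h, h]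
  have aux : ∀ (q y : NC2 k) (s : Fin (2 * k) → Fin (2 * k)) (i : Fin (2 * k)),
      Quot.mk (closedRel q y s)
        (Sum.elim (outer k) (fun x : Fin (2 * k) => Sum.inr x.rev) (outer k i)) =
      Quot.mk (closedRel q y s) (Sum.inl i) := by
    intro q y s i
    rcases lt_or_ge i.val k with hi | hi
    · rw [outer_of_lt hi, Sum.elim_inl, outer_of_lt hi]
    · rw [outer_of_le hi, Sum.elim_inr, ← closedRel_glue _ (rev_lt_iff.2 hi), Fin.rev_rev]
  have main : ∀ (t y q q' : NC2 k), (∀ i, q'.1 i = (q.1 i.rev).rev) →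
      ∀ x x', closedRel q y t.1 x x' →
      Quot.mk (closedRel q' t y.1) (Sum.elim (outer k) (fun x : Fin (2 * k) => Sum.inr x.rev) x) =
      Quot.mk (closedRel q' t y.1)
        (Sum.elim (outer k) (fun x : Fin (2 * k) => Sum.inr x.rev) x') := by
    intro t y q q' hq
    refine closedRel_induction _ ?_ ?_ ?_ ?_
    · exact closedRel_outer
    · intro i
      simp only [Sum.elim_inr]
      rw [closedRel_inr, hq, Fin.rev_rev]
    · intro j hj
      simp only [Sum.elim_inr, Sum.elim_inl]
      rw [outer_of_le (le_rev_iff.2 hj)]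
    · intro i
      rw [aux, aux]
      exact closedRel_inl i
  have inv : ∀ (q y : NC2 k) (s : Fin (2 * k) → Fin (2 * k)) (x),
      Quot.mk (closedRel q y s) (Sum.elim (outer k) (fun x : Fin (2 * k) => Sum.inr x.rev)
        (Sum.elim (outer k) (fun x : Fin (2 * k) => Sum.inr x.rev) x)) =
      Quot.mk (closedRel q y s) x := by
    rintro q y s (i | i)
    · exact aux q y s i
    · simp
  exact card_quot_congr _ _ (main t y q (flip q) fun i => rfl)
    (main y t (flip q) q fun i => by simp [flip_apply]) (inv _ _ _) (inv _ _ _)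

theorem stackLoops_add_loops_right {k : ℕ} (t q y : NC2 k) :
    stackLoops q y + loops (stack q y) t = stackLoops t (flip y) + loops (stack t (flip y)) q := by
  have h : ∀ t q y : NC2 k, stackLoops q y + loops (stack q y) t =
      Nat.card (Quot (closedRel q y t.1)) := fun t q y => (card_closedRel q y t.1).symm
  rw [h, h]
  have aux : ∀ (q y : NC2 k) (s : Fin (2 * k) → Fin (2 * k)) (i : Fin (2 * k)),
      Quot.mk (closedRel q y s)
        (Sum.elim (fun x : Fin (2 * k) => Sum.inl x.rev) (outer k) (outer k i)) =
      Quot.mk (closedRel q y s) (Sum.inr i) := by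
    intro q y s i
    rcases lt_or_ge i.val k with hi | hi
    · rw [outer_of_lt hi, Sum.elim_inl, closedRel_glue _ hi]
    · rw [outer_of_le hi, Sum.elim_inr, outer_of_le hi]
  have main : ∀ (t q y y' : NC2 k), (∀ i, y'.1 i = (y.1 i.rev).rev) →
      ∀ x x', closedRel q y t.1 x x' →
      Quot.mk (closedRel t y' q.1) (Sum.elim (fun x : Fin (2 * k) => Sum.inl x.rev) (outer k) x) =
      Quot.mk (closedRel t y' q.1)
        (Sum.elim (fun x : Fin (2 * k) => Sum.inl x.rev) (outer k) x') := by
    intro t q y y' hy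
    refine closedRel_induction _ ?_ ?_ ?_ ?_
    · intro i
      simp only [Sum.elim_inl]
      rw [closedRel_inl, hy, Fin.rev_rev]
    · exact closedRel_outer
    · intro j hj
      simp only [Sum.elim_inr, Sum.elim_inl]
      rw [outer_of_lt hj, Fin.rev_rev]
    · intro i
      rw [aux, aux]
      exact closedRel_inr i
  have inv : ∀ (q y : NC2 k) (s : Fin (2 * k) → Fin (2 * k)) (x),
      Quot.mk (closedRel q y s) (Sum.elim (fun x : Fin (2 * k) => Sum.inl x.rev) (outer k)
        (Sum.elim (fun x : Fin (2 * k) => Sum.inl x.rev) (outer k) x)) =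
      Quot.mk (closedRel q y s) x := by
    rintro q y s (i | i)
    · simp
    · exact aux q y s i
  exact card_quot_congr _ _ (main t q y (flip y) fun i => rfl)
    (main q t (flip y) y fun i => by simp [flip_apply]) (inv _ _ _) (inv _ _ _)

/-! ### Pairings as functions on the natural numbers -/

/-- The partner of a point, as a function on the natural numbers. -/
def partner {k : ℕ} (p : NC2 k) (x : ℕ) : ℕ := if h : x < 2 * k then (p.1 ⟨x, h⟩).val else x

section partner

variable {k : ℕ} (p : NC2 k)

theorem partner_val (x : Fin (2 * k)) : partner p x.val = (p.1 x).val := by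
  simp [partner]

theorem partner_lt {x : ℕ} (h : x < 2 * k) : partner p x < 2 * k := by
  simp [partner, h]

theorem partner_partner (x : ℕ) : partner p (partner p x) = x := by
  by_cases h : x < 2 * k
  · have h1 : partner p x = (p.1 ⟨x, h⟩).val := by simp [partner, h]
    rw [h1, partner_val, p.2.1]
  -- Outside the range `partner` is the identity, so it is an involution without side conditions.
  · have h1 : partner p x = x := dif_neg h
    rw [h1, h1]

theorem partner_ne {x : ℕ} (h : x < 2 * k) : partner p x ≠ x := by
  have := p.2.2.1 ⟨x, h⟩
  simpa [partner, h, Fin.ext_iff] using this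

theorem partner_noncrossing {a b : ℕ} (h1 : a < b) (h2 : b < partner p a)
    (h3 : partner p a < partner p b) : b < 2 * k → False := by
  intro hb
  have ha : a < 2 * k := by omega
  refine p.2.2.2 ⟨a, ha⟩ ⟨b, hb⟩ (p.1 ⟨a, ha⟩) (p.1 ⟨b, hb⟩) h1 ?_ ?_ rfl rfl
  · rw [Fin.lt_def, ← partner_val]
    exact h2
  · rw [Fin.lt_def, ← partner_val, ← partner_val]
    exact h3

variable {p}

theorem NC2.ext {q : NC2 k} (h : ∀ x < 2 * k, partner p x = partner q x) : p = q := by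
  refine Subtype.ext (funext fun x => Fin.ext ?_)
  rw [← partner_val, ← partner_val, h _ x.2]

end partner

/-- The non-crossing pairing that is given by a function on the natural numbers. -/
def NC2.ofFun {k : ℕ} (f : ℕ → ℕ) (h1 : ∀ x < 2 * k, f x < 2 * k ∧ f (f x) = x ∧ f x ≠ x)
    (h2 : ∀ a b, a < b → b < f a → f a < f b → b < 2 * k → False) : NC2 k :=
  ⟨fun x => ⟨f x, (h1 x x.2).1⟩, fun x => Fin.ext (h1 x x.2).2.1,
    fun x h => (h1 x x.2).2.2 (congrArg Fin.val h), by
      rintro a b c d hab hbc hcd rfl rfl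
      exact h2 a b hab hbc hcd b.2⟩

theorem partner_ofFun {k : ℕ} {f : ℕ → ℕ} (h1 : ∀ x < 2 * k, f x < 2 * k ∧ f (f x) = x ∧ f x ≠ x)
    (h2 : ∀ a b, a < b → b < f a → f a < f b → b < 2 * k → False) {x : ℕ} (hx : x < 2 * k) :
    partner (NC2.ofFun f h1 h2) x = f x := by
  simp [partner, hx, NC2.ofFun]

/-! ### Cups and caps -/

/-- The increasing enumeration of the natural numbers other than `i` and `i + 1`. -/
def skip (i x : ℕ) : ℕ := if x < i then x else x + 2

/-- The inverse of `skip`. -/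
def unskip (i y : ℕ) : ℕ := if y < i then y else y - 2

theorem unskip_skip (i x : ℕ) : unskip i (skip i x) = x := by
  unfold unskip skip; split_ifs <;> omega

theorem skip_unskip {i y : ℕ} (h1 : y ≠ i) (h2 : y ≠ i + 1) : skip i (unskip i y) = y := by
  unfold unskip skip; split_ifs <;> omega

theorem skip_ne (i x : ℕ) : skip i x ≠ i ∧ skip i x ≠ i + 1 := by
  unfold skip; split_ifs <;> omega

theorem skip_lt_skip {i x y : ℕ} : skip i x < skip i y ↔ x < y := by
  unfold skip; split_ifs <;> omega

theorem skip_inj {i x y : ℕ} : skip i x = skip i y ↔ x = y := by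
  unfold skip; split_ifs <;> omega

theorem skip_lt {i x k : ℕ} (hi : i ≤ 2 * k) : skip i x < 2 * (k + 1) ↔ x < 2 * k := by
  unfold skip; split_ifs <;> omega

theorem exists_skip {i y : ℕ} (h1 : y ≠ i) (h2 : y ≠ i + 1) : ∃ x, y = skip i x :=
  ⟨_, (skip_unskip h1 h2).symm⟩

/-- The function of the pairing with a new pair `{i, i + 1}`. -/
def cupFun (i : ℕ) (f : ℕ → ℕ) (y : ℕ) : ℕ :=
  if y = i then i + 1 else if y = i + 1 then i else skip i (f (unskip i y))

theorem cupFun_left (i : ℕ) (f : ℕ → ℕ) : cupFun i f i = i + 1 := if_pos rfl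

theorem cupFun_right (i : ℕ) (f : ℕ → ℕ) : cupFun i f (i + 1) = i := by
  simp [cupFun]

theorem cupFun_skip (i : ℕ) (f : ℕ → ℕ) (x : ℕ) : cupFun i f (skip i x) = skip i (f x) := by
  have := skip_ne i x
  simp [cupFun, this, unskip_skip]

/-- Insert two neighbouring points at the positions `i`, `i + 1` and join them. -/
def cup {k : ℕ} (i : ℕ) (hi : i ≤ 2 * k) (p : NC2 k) : NC2 (k + 1) :=
  NC2.ofFun (cupFun i (partner p))
    (by
      intro y hy
      by_cases h1 : y = i
      · subst h1
        rw [cupFun_left, cupFun_right]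
        omega
      by_cases h2 : y = i + 1
      · subst h2
        rw [cupFun_right, cupFun_left]
        omega
      obtain ⟨x, rfl⟩ := exists_skip h1 h2
      rw [skip_lt hi] at hy
      rw [cupFun_skip, cupFun_skip, skip_lt hi, partner_partner]
      exact ⟨partner_lt p hy, rfl, fun e => partner_ne p hy (skip_inj.1 e)⟩)
    (by
      intro a b hab hba h hb
      by_cases ha1 : a = i
      · subst ha1
        rw [cupFun_left] at hba
        omega
      by_cases ha2 : a = i + 1
      · subst ha2
        rw [cupFun_right] at hba
        omega
      by_cases hb1 : b = i
      · subst hb1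
        rw [cupFun_left] at h
        omega
      by_cases hb2 : b = i + 1
      · subst hb2
        rw [cupFun_right] at h
        omega
      obtain ⟨a, rfl⟩ := exists_skip ha1 ha2
      obtain ⟨b, rfl⟩ := exists_skip hb1 hb2
      rw [cupFun_skip] at hba h
      rw [cupFun_skip] at h
      rw [skip_lt_skip] at hab hba h
      exact partner_noncrossing p hab hba h ((skip_lt hi).1 hb))

section cup

variable {k i : ℕ} (hi : i ≤ 2 * k) (p : NC2 k)

theorem partner_cup {y : ℕ} (hy : y < 2 * (k + 1)) :
    partner (cup i hi p) y = cupFun i (partner p) y :=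
  partner_ofFun _ _ hy

theorem partner_cup_left : partner (cup i hi p) i = i + 1 := by
  rw [partner_cup _ _ (by omega), cupFun_left]

theorem partner_cup_right : partner (cup i hi p) (i + 1) = i := by
  rw [partner_cup _ _ (by omega), cupFun_right]

theorem partner_cup_skip (x : ℕ) : partner (cup i hi p) (skip i x) = skip i (partner p x) := by
  by_cases hx : x < 2 * k
  · rw [partner_cup _ _ ((skip_lt hi).2 hx), cupFun_skip]
  · have h1 : ¬ skip i x < 2 * (k + 1) := by rwa [skip_lt hi]
    simp [partner, hx, h1]

end cup

/-- The partners after joining the points `i` and `i + 1`. -/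
def glueFun (i : ℕ) (f : ℕ → ℕ) (z : ℕ) : ℕ :=
  if f z = i then f (i + 1) else if f z = i + 1 then f i else f z

/-- An instance of `IsState.glue` with the points themselves as positions. Only the involution and
non-crossing parts are needed later, so the relation may stay anonymous. -/
theorem isState_glueFun {k : ℕ} (i : ℕ) (hi : i ≤ 2 * k) (p : NC2 (k + 1)) :
    ∃ R, IsState id R {x | x < 2 * (k + 1) ∧ x ≠ i ∧ x ≠ i + 1} (glueFun i (partner p)) := by
  have h : IsState id (fun x y => y = partner p x) {x | x < 2 * (k + 1)} (partner p) := by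
    refine ⟨fun x hx => ⟨partner_lt p hx, partner_partner p x, partner_ne p hx⟩, ?_, ?_⟩
    · exact fun x _ y hy h1 h2 h3 => partner_noncrossing p h1 h2 h3 hy
    · exact fun x _ y _ => eqvGen_involution (partner_partner p) x y
  have h' := h.glue Function.injective_id (a := i) (b := i + 1) (by simp; omega) (by simp; omega)
    (by simp) (by intro x _; simp only [id]; omega)
  refine ⟨fun u v => v = partner p u ∨ u = i ∧ v = i + 1, ?_⟩
  convert h' using 1
  · simp
  · funext x
    unfold glueFun
    split_ifs <;> rfl

/-- Join the neighbouring points `i` and `i + 1`, and remove them. -/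
def cap {k : ℕ} (i : ℕ) (hi : i ≤ 2 * k) (p : NC2 (k + 1)) : NC2 k :=
  NC2.ofFun (fun x => unskip i (glueFun i (partner p) (skip i x)))
    (by
      intro x hx
      obtain ⟨R, h, -, -⟩ := isState_glueFun i hi p
      have hs := skip_ne i x
      obtain ⟨⟨h1, h2, h3⟩, h4, h5⟩ := h (skip i x) ⟨(skip_lt hi).2 hx, hs⟩
      have e := skip_unskip h2 h3
      rw [e, h4, unskip_skip]
      refine ⟨?_, rfl, ?_⟩
      · rwa [← skip_lt hi, e]
      · rwa [Ne, ← skip_inj (i := i), e])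
    (by
      intro a b h1 h2 h3 hb
      obtain ⟨R, h, h', -⟩ := isState_glueFun i hi p
      have ha : a < 2 * k := by omega
      have ma : skip i a ∈ {x | x < 2 * (k + 1) ∧ x ≠ i ∧ x ≠ i + 1} :=
        ⟨(skip_lt hi).2 ha, skip_ne i a⟩
      have mb : skip i b ∈ {x | x < 2 * (k + 1) ∧ x ≠ i ∧ x ≠ i + 1} :=
        ⟨(skip_lt hi).2 hb, skip_ne i b⟩
      obtain ⟨⟨-, ha2, ha3⟩, -, -⟩ := h _ ma
      obtain ⟨⟨-, hb2, hb3⟩, -, -⟩ := h _ mb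
      refine h' _ ma _ mb (skip_lt_skip.2 h1) ?_ ?_
      · rw [← skip_lt_skip (i := i), skip_unskip ha2 ha3] at h2
        exact h2
      · rw [← skip_lt_skip (i := i), skip_unskip ha2 ha3, skip_unskip hb2 hb3] at h3
        exact h3)

section cap

variable {k i : ℕ} (hi : i ≤ 2 * k) (p : NC2 (k + 1))

theorem skip_partner_cap {x : ℕ} (hx : x < 2 * k) :
    skip i (partner (cap i hi p) x) = glueFun i (partner p) (skip i x) := by
  obtain ⟨R, h, -, -⟩ := isState_glueFun i hi p
  obtain ⟨⟨-, h2, h3⟩, -, -⟩ := h (skip i x) ⟨(skip_lt hi).2 hx, skip_ne i x⟩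
  rw [cap, partner_ofFun _ _ hx, skip_unskip h2 h3]

theorem cap_cup (p : NC2 k) : cap i hi (cup i hi p) = p := by
  refine NC2.ext fun x hx => ?_
  rw [← skip_inj (i := i), skip_partner_cap hi _ hx, glueFun, partner_cup_skip]
  have := skip_ne i (partner p x)
  simp [this]

variable {p}

theorem cup_cap (h : partner p i = i + 1) : cup i hi (cap i hi p) = p := by
  have h' : partner p (i + 1) = i := by rw [← h, partner_partner]
  refine NC2.ext fun y hy => ?_
  by_cases h1 : y = i
  · rw [h1, partner_cup_left, h]
  by_cases h2 : y = i + 1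
  · rw [h2, partner_cup_right, h']
  obtain ⟨x, rfl⟩ := exists_skip h1 h2
  have e1 : partner p (skip i x) ≠ i := fun e => h2 (by rw [← partner_partner p (skip i x), e, h])
  have e2 : partner p (skip i x) ≠ i + 1 := fun e => h1 (by
    rw [← partner_partner p (skip i x), e, h'])
  rw [partner_cup_skip, skip_partner_cap hi _ ((skip_lt hi).1 hy), glueFun, if_neg e1, if_neg e2]

end cap

theorem partner_eq_succ_iff {k i : ℕ} (hi : i ≤ 2 * k) (p : NC2 (k + 1)) :
    partner p i = i + 1 ↔ cup i hi (cap i hi p) = p :=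
  ⟨cup_cap hi, fun h => by rw [← h, partner_cup_left]⟩

/-- The zig-zag relation: a cup followed by a cap shifted by one straightens to a plain strand. -/
theorem cap_succ_cup {k i : ℕ} (hi : i ≤ 2 * k) (hi' : i + 1 ≤ 2 * k) (p : NC2 k) :
    cap (i + 1) hi' (cup i hi p) = p := by
  refine NC2.ext fun x hx => ?_
  rw [← skip_inj (i := i + 1), skip_partner_cap hi' _ hx, glueFun, partner_cup_right]
  have h1 := partner_partner p x
  have h2 := partner_partner p i
  have e0 : partner (cup i hi p) (i + 1 + 1) = skip i (partner p i) := by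
    rw [← partner_cup_skip hi]; simp [skip]
  rw [e0]
  by_cases hxi : x = i
  · subst hxi
    have e1 : skip (x + 1) x = x := by simp [skip]
    rw [e1, partner_cup_left, if_pos rfl]
    have := partner_ne p hx
    unfold skip
    split_ifs <;> omega
  · have e1 : skip (i + 1) x = skip i x := by
      unfold skip; split_ifs <;> omega
    rw [e1, partner_cup_skip]
    by_cases hp : partner p x = i
    · have e2 : skip i i = i + 1 + 1 := by simp [skip]
      rw [hp, e2, if_neg (by omega), if_pos rfl]
      simp [skip]
    · unfold skip
      split_ifs <;> omega

/-- Non-crossing traps the partner of `a + 1` below the arc from `a` to `b`, so one can descend to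
shorter and shorter arcs. -/
theorem exists_partner_eq_succ {k : ℕ} (p : NC2 k) {a b : ℕ} (hab : a < b) (hb : b < 2 * k)
    (h : partner p a = b) : ∃ i, a ≤ i ∧ i < b ∧ partner p i = i + 1 := by
  induction hn : b - a using Nat.strong_induction_on generalizing a b with
  | _ n ih =>
    by_cases h1 : b = a + 1
    · exact ⟨a, le_rfl, hab, by omega⟩
    have hc := partner_lt p (x := a + 1) (by omega)
    have hcc := partner_partner p (a + 1)
    have hcn := partner_ne p (x := a + 1) (by omega)
    have hba : partner p b = a := by rw [← h, partner_partner]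
    have c1 : partner p (a + 1) ≠ a := fun e => by rw [e] at hcc; omega
    have c2 : partner p (a + 1) ≠ b := fun e => by rw [e] at hcc; omega
    have c3 : ¬ partner p (a + 1) < a := fun e => by
      refine partner_noncrossing p e (b := a) ?_ ?_ (by omega) <;> omega
    have c4 : ¬ b < partner p (a + 1) := fun e =>
      partner_noncrossing p (a := a) (b := a + 1) (by omega) (by omega) (by omega) (by omega)
    obtain ⟨i, hi1, hi2, hi3⟩ := ih _ (by omega) (a := a + 1) (b := partner p (a + 1)) (by omega)
      (by omega) rfl rfl
    exact ⟨i, by omega, by omega, hi3⟩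

theorem exists_eq_cup {k : ℕ} (p : NC2 (k + 1)) :
    ∃ (i : ℕ) (hi : i ≤ 2 * k) (r : NC2 k), p = cup i hi r := by
  have h0 := partner_lt p (x := 0) (by omega)
  have h1 := partner_ne p (x := 0) (by omega)
  obtain ⟨i, -, hi, h⟩ := exists_partner_eq_succ p (a := 0) (by omega) h0 rfl
  exact ⟨i, by omega, cap i (by omega) p, (cup_cap _ h).symm⟩

/-! ### The loop count when a cup is moved across as a cap. -/

theorem skip_fin {k : ℕ} {i : ℕ} (hi : i ≤ 2 * k) (x : Fin (2 * k)) : skip i x < 2 * (k + 1) :=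
  (skip_lt hi).2 x.2

/-- Gluing a cup at `i`, `i + 1` onto `q` joins these two points of `q`, which is what `cap` does; a
separate loop closes exactly when `q` already pairs them. This recursion drives all the inductions
on `k`. -/
theorem loops_cup {k i : ℕ} (hi : i ≤ 2 * k) (r : NC2 k) (q : NC2 (k + 1)) :
    loops (cup i hi r) q = (if partner q i = i + 1 then 1 else 0) + loops r (cap i hi q) := by
  let a : Fin (2 * (k + 1)) := ⟨i, by omega⟩
  let b : Fin (2 * (k + 1)) := ⟨i + 1, by omega⟩
  let o : Fin (2 * k) → Fin (2 * (k + 1)) := fun x => ⟨skip i x, skip_fin hi x⟩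
  let R : Fin (2 * (k + 1)) → Fin (2 * (k + 1)) → Prop := fun x y => y = q.1 x ∨ (x = a ∧ y = b)
  have hab : a ≠ b := by simp [a, b]
  have ho : ∀ x, o x ≠ a ∧ o x ≠ b := fun x => by
    simpa [o, a, b, Fin.ext_iff] using skip_ne i x
  have hoe : ∀ y, y ≠ a → y ≠ b → ∃ x, y = o x := by
    intro y h1 h2
    obtain ⟨x, hx⟩ := exists_skip (i := i) (y := y) (by simpa [a, Fin.ext_iff] using h1)
      (by simpa [b, Fin.ext_iff] using h2)
    have := y.2
    rw [hx, skip_lt hi] at this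
    exact ⟨⟨x, this⟩, Fin.ext hx⟩
  have hoi : ∀ x y, o x = o y ↔ x = y := fun x y => by
    simp [o, Fin.ext_iff, skip_inj]
  have hR : ∀ x y, Quot.mk R x = Quot.mk R y ↔ (x = y ∨ q.1 x = y) ∨
      ((x = a ∨ q.1 x = a) ∧ (b = y ∨ q.1 b = y)) ∨
        ((x = b ∨ q.1 x = b) ∧ (a = y ∨ q.1 a = y)) := by
    intro x y
    rw [Quot.eq, eqvGen_glue]
    simp only [eqvGen_involution q.2.1]
  have hcap : ∀ x, o ((cap i hi q).1 x) =
      if q.1 (o x) = a then q.1 b else if q.1 (o x) = b then q.1 a else q.1 (o x) := by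
    intro x
    have h := skip_partner_cap hi q x.2
    rw [partner_val] at h
    have e : ∀ z : Fin (2 * (k + 1)), partner q z.val = (q.1 z).val := partner_val q
    rw [glueFun, show skip i x.val = (o x).val from rfl, show i + 1 = b.val from rfl,
      show partner q i = partner q a.val from rfl, e, e, e] at h
    apply Fin.ext
    change skip i _ = _
    rw [h]
    have e1 : ∀ z : Fin (2 * (k + 1)), z.val = i ↔ z = a := fun z => by simp [a, Fin.ext_iff]
    simp only [e1, Fin.val_inj]
    split_ifs <;> rfl
  have hq := q.2.1
  have main := card_quot_outer o R (fun x y => y = (cap i hi q).1 x) (fun x y => y = r.1 x) (by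
    intro x y
    rw [quot_mk_involution (cap i hi q).2.1, hR, ← hoi, ← hoi, hcap]
    have h1 := ho x
    have h2 := ho y
    generalize o x = x at *
    generalize o y = y at *
    constructor
    · rintro (h | h)
      · exact Or.inl (Or.inl h)
      · split_ifs at h <;> grind
    · rintro ((h | h) | ⟨h, h'⟩ | ⟨h, h'⟩)
      · exact Or.inl h
      · right
        subst h
        rw [if_neg h2.1, if_neg h2.2]
      · right
        have h3 : q.1 x = a := h.resolve_left h1.1
        rw [if_pos h3]
        exact h'.resolve_left h2.2.symm
      · right
        have h3 : q.1 x = b := h.resolve_left h1.2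
        rw [if_neg (by rw [h3]; exact hab.symm), if_pos h3]
        exact h'.resolve_left h2.1.symm)
  have e1 : loops (cup i hi r) q =
      Nat.card (Quot fun x y => R x y ∨ ∃ i j, x = o i ∧ y = o j ∧ j = r.1 i) := by
    have hcup : ∀ x, (cup i hi r).1 (o x) = o (r.1 x) := by
      intro x
      apply Fin.ext
      rw [← partner_val]
      change partner _ (skip i x) = skip i _
      rw [partner_cup_skip, partner_val]
    have hcupa : (cup i hi r).1 a = b := by
      apply Fin.ext
      rw [← partner_val]
      exact partner_cup_left hi r
    have hcupb : (cup i hi r).1 b = a := by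
      rw [← hcupa, (cup i hi r).2.1]
    refine card_quot_congr id id ?_ ?_ (fun _ => rfl) (fun _ => rfl)
    · rintro x y (h | h)
      · by_cases hxa : x = a
        · subst hxa
          rw [hcupa] at h
          exact Quot.sound (Or.inl (Or.inr (And.intro rfl h)))
        by_cases hxb : x = b
        · subst hxb
          rw [hcupb] at h
          exact (Quot.sound (r := fun x y => R x y ∨ ∃ i j, x = o i ∧ y = o j ∧ j = r.1 i)
            (Or.inl (Or.inr ⟨h, rfl⟩))).symm
        obtain ⟨x, rfl⟩ := hoe x hxa hxb
        rw [hcup] at h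
        exact Quot.sound (Or.inr ⟨x, _, rfl, h, rfl⟩)
      · exact Quot.sound (Or.inl (Or.inl h))
    · rintro x y ((h | ⟨rfl, rfl⟩) | ⟨x, y, rfl, rfl, rfl⟩)
      · exact Quot.sound (Or.inr h)
      · exact Quot.sound (Or.inl hcupa.symm)
      · exact Quot.sound (Or.inl (hcup x).symm)
  rw [e1, main]
  -- Every component without outer points is that of `a` and `b`, and it has no outer points only if
  -- `q` pairs `a` with `b`.
  congr 1
  · have hmk : Quot.mk R b = Quot.mk R a := (Quot.sound (r := R) (Or.inr ⟨rfl, rfl⟩)).symm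
    have hqa : partner q i = i + 1 ↔ q.1 a = b := by
      rw [show partner q i = partner q a.val from rfl, partner_val, Fin.ext_iff]
    have hout : ∀ c : Quot R, (∀ x, Quot.mk R (o x) ≠ c) → c = Quot.mk R a := by
      rintro ⟨y⟩ hy
      by_cases hya : y = a
      · rw [hya]
      by_cases hyb : y = b
      · rw [hyb, hmk]
      obtain ⟨x, rfl⟩ := hoe y hya hyb
      exact absurd rfl (hy x)
    split_ifs with h
    · rw [hqa] at h
      have hb' : q.1 b = a := by rw [← h, hq]
      rw [Nat.card_eq_one_iff_unique]
      refine ⟨⟨fun c c' => Subtype.ext ((hout _ c.2).trans (hout _ c'.2).symm)⟩,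
        ⟨⟨Quot.mk R a, fun x e => ?_⟩⟩⟩
      have := ho x
      have e2 := (hR _ _).1 e
      grind
    · rw [hqa] at h
      rw [Nat.card_eq_zero]
      left
      refine ⟨fun c => ?_⟩
      have hqaa := q.2.2.1 a
      obtain ⟨x, hx⟩ := hoe (q.1 a) hqaa h
      refine c.2 x ?_
      rw [hout _ c.2, ← hx]
      exact (Quot.sound (r := R) (Or.inl rfl)).symm
  · unfold loops
    congr 1
    simp only [or_comm]

/-! ### Transitivity of the cup-cap moves -/

theorem skip_add_two (j x : ℕ) : skip (j + 2) (x + 2) = skip j x + 2 := by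
  unfold skip; split_ifs <;> omega

theorem skip_lt_or_lt (i x : ℕ) : skip i x < i ∨ i + 1 < skip i x := by
  unfold skip; split_ifs <;> omega

theorem skip_zero (x : ℕ) : skip 0 x = x + 2 := by
  simp [skip]

theorem partner_cup_zero {k : ℕ} (p : NC2 k) (x : ℕ) :
    partner (cup 0 (Nat.zero_le _) p) (x + 2) = partner p x + 2 := by
  rw [← skip_zero, partner_cup_skip, skip_zero]

theorem partner_cup_one {k : ℕ} (p : NC2 k) : partner (cup 0 (Nat.zero_le _) p) 1 = 0 :=
  partner_cup_right (Nat.zero_le _) p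

theorem cup_zero_cup {k j : ℕ} (hj : j ≤ 2 * k) (p : NC2 k) :
    cup 0 (Nat.zero_le _) (cup j hj p) =
      cup (j + 2) (by omega) (cup 0 (Nat.zero_le _) p) := by
  refine NC2.ext fun y hy => ?_
  have e0 : ∀ m, skip (j + 2) m = if m < j + 2 then m else m + 2 := fun m => rfl
  by_cases h0 : y = 0
  · subst h0
    rw [partner_cup_left]
    have := partner_cup_skip (i := j + 2) (by omega) (cup 0 (Nat.zero_le _) p) 0
    rw [partner_cup_left, e0, if_pos (by omega), e0, if_pos (by omega)] at this
    exact this.symm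
  by_cases h1 : y = 1
  · subst h1
    have := partner_cup_skip (i := j + 2) (by omega) (cup 0 (Nat.zero_le _) p) 1
    rw [e0, if_pos (by omega)] at this
    rw [this, partner_cup_one, partner_cup_one, e0, if_pos (by omega)]
  obtain ⟨y, rfl⟩ : ∃ z, y = z + 2 := ⟨y - 2, by omega⟩
  rw [partner_cup_zero]
  by_cases hyj : y = j
  · rw [hyj, partner_cup_left, partner_cup_left]
  by_cases hyj' : y = j + 1
  · rw [hyj', partner_cup_right, show j + 1 + 2 = j + 2 + 1 by omega, partner_cup_right]
  obtain ⟨x, rfl⟩ := exists_skip hyj hyj'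
  rw [partner_cup_skip, ← skip_add_two j x, partner_cup_skip, partner_cup_zero, skip_add_two]

theorem cap_cup_zero {k j : ℕ} (hj : j ≤ 2 * k) (p : NC2 (k + 1)) :
    cap (j + 2) (by omega) (cup 0 (Nat.zero_le _) p) =
      cup 0 (Nat.zero_le _) (cap j hj p) := by
  refine NC2.ext fun y hy => ?_
  have e0 : ∀ m, skip (j + 2) m = if m < j + 2 then m else m + 2 := fun m => rfl
  rw [← skip_inj (i := j + 2), skip_partner_cap _ _ hy]
  by_cases h0 : y = 0
  · subst h0
    rw [partner_cup_left, e0, if_pos (by omega), e0, if_pos (by omega), glueFun, partner_cup_left,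
      if_neg (by omega), if_neg (by omega)]
  by_cases h1 : y = 1
  · subst h1
    rw [partner_cup_one, e0, if_pos (by omega), e0, if_pos (by omega), glueFun,
      partner_cup_one, if_neg (by omega), if_neg (by omega)]
  obtain ⟨y, rfl⟩ : ∃ z, y = z + 2 := ⟨y - 2, by omega⟩
  have h := skip_partner_cap hj p (x := y) (by omega)
  rw [partner_cup_zero, skip_add_two, skip_add_two, h, glueFun, glueFun, partner_cup_zero,
    partner_cup_zero, show j + 2 + 1 = j + 1 + 2 by omega, partner_cup_zero]
  simp only [add_left_inj]
  split_ifs <;> rfl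

theorem NC2.subsingleton_zero : Subsingleton (NC2 0) :=
  ⟨fun _ _ => NC2.ext fun _ hx => by omega⟩

/-- A non-empty set of non-crossing pairings that is closed under joining neighbouring points
contains all of them. -/
theorem mem_of_closed {k : ℕ} (P : Set (NC2 (k + 1))) (hP : P.Nonempty)
    (h : ∀ i (hi : i ≤ 2 * k), ∀ q ∈ P, cup i hi (cap i hi q) ∈ P) (q : NC2 (k + 1)) : q ∈ P := by
  -- The pairings whose insertion after a cup at 0 lies in `P` are closed under the moves one level
  -- down, because a move at `j + 2` does not touch that cup.
  have all : ∀ r, cup 0 (Nat.zero_le _) r ∈ P := by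
    obtain ⟨p, hp⟩ := hP
    have hp' := h 0 (Nat.zero_le _) p hp
    cases k with
    | zero =>
      intro r
      rwa [NC2.subsingleton_zero.elim r (cap 0 _ p)]
    | succ k =>
      refine mem_of_closed {r | cup 0 (Nat.zero_le _) r ∈ P} ⟨_, hp'⟩ fun j hj r hr => ?_
      have := h (j + 2) (by omega) _ hr
      rwa [cap_cup_zero hj, ← cup_zero_cup] at this
  -- By the zig-zag relation, the move at `i + 1` slides a cup from `i` to `i + 1` and leaves the
  -- rest unchanged.
  have hall : ∀ i (hi : i ≤ 2 * k) r, cup i hi r ∈ P := by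
    intro i
    induction i with
    | zero => exact fun _ r => all r
    | succ i ih =>
      intro hi r
      have := h (i + 1) hi _ (ih (by omega) r)
      rwa [cap_succ_cup] at this
  obtain ⟨i, hi, r, rfl⟩ := exists_eq_cup q
  exact hall i hi r

/-! ### The neighbours of the diagrams with one cup and one cap -/

/-- The pairing of the identity diagram. -/
def rainbow (k : ℕ) : NC2 k :=
  NC2.ofFun (fun x => 2 * k - 1 - x) (fun x hx => by omega) (fun a b => by omega)

theorem partner_rainbow {k x : ℕ} (hx : x < 2 * k) : partner (rainbow k) x = 2 * k - 1 - x :=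
  partner_ofFun _ _ hx

/-- Undoing the cap means cutting one strand of the rainbow and attaching its ends to `i` and `i +
1`. Only the strands next to position `i` can be reached without a crossing. At `i = k` the path is
folded: a pair inserted just before or just after the innermost strand gives the same pairing, so
one neighbour is left. -/
theorem eq_cup_rainbow_of_cap_eq {k i : ℕ} (hi : i ≤ k) (q : NC2 (k + 1))
    (h : cap i (by omega) q = rainbow k) (hq : q ≠ cup i (by omega) (rainbow k)) :
    (∃ hik : i < k, q = cup (i + 1) (by omega) (rainbow k)) ∨
      (∃ _ : 0 < i, q = cup (i - 1) (by omega) (rainbow k)) := by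
  have hi' : i ≤ 2 * k := by omega
  have hai : partner q i ≠ i + 1 := fun e => hq (by rw [← h, cup_cap _ e])
  have hcap : ∀ z, z < 2 * (k + 1) → z ≠ i → z ≠ i + 1 →
      glueFun i (partner q) z = skip i (2 * k - 1 - unskip i z) := by
    intro z hz h1 h2
    obtain ⟨x, rfl⟩ := exists_skip h1 h2
    rw [skip_lt hi'] at hz
    rw [← skip_partner_cap hi' q hz, h, partner_rainbow hz, unskip_skip]
  have hcup : ∀ j (hj : j ≤ 2 * k) y, y < 2 * (k + 1) → partner (cup j hj (rainbow k)) y =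
      if y = j then j + 1 else if y = j + 1 then j else skip j (2 * k - 1 - unskip j y) := by
    intro j hj y hy
    by_cases h1 : y = j
    · rw [if_pos h1, h1, partner_cup_left]
    by_cases h2 : y = j + 1
    · rw [if_neg h1, if_pos h2, h2, partner_cup_right]
    obtain ⟨x, rfl⟩ := exists_skip h1 h2
    rw [skip_lt hj] at hy
    rw [if_neg h1, if_neg h2, partner_cup_skip, partner_rainbow hy, unskip_skip]
  have hinv := partner_partner q
  have hlt := fun z => partner_lt q (x := z)
  have hne := fun z => partner_ne q (x := z)
  have hnc := fun a b => partner_noncrossing q (a := a) (b := b)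
  generalize hf : partner q = f at *
  have hT : ∀ z, z < 2 * (k + 1) → z ≠ i → z ≠ i + 1 → f z ≠ i → f z ≠ i + 1 →
      f z = skip i (2 * k - 1 - unskip i z) := by
    intro z hz h1 h2 h3 h4
    rw [← hcap z hz h1 h2, glueFun, if_neg h3, if_neg h4]
  have ha0 := hne i (by omega)
  have hla := hlt i (by omega)
  have hb0 := hne (i + 1) (by omega)
  have hlb := hlt (i + 1) (by omega)
  have hfa := hinv i
  have hfb := hinv (i + 1)
  have hTa := hcap (f i) hla ha0 hai
  rw [glueFun, hfa, if_pos rfl] at hTa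
  have hbi : f (i + 1) ≠ i := fun e => hai (by rw [← hfb, e])
  have hinj : ∀ x y, f x = f y → x = y := fun x y e => by rw [← hinv x, e, hinv]
  obtain hlt' | hgt' : f i < i ∨ i + 1 < f i := by omega
  · right
    have e1 : f (i + 1) = 2 * k + 1 - f i := by
      rw [hTa]; unfold skip unskip; split_ifs <;> omega
    -- Otherwise the point `i - 1` keeps its rainbow strand, which would cross the strand from `f i`
    -- to `i`.
    have e2 : f i = i - 1 := by
      by_contra hc
      have c1 : f (i - 1) ≠ i := fun e => hc (by rw [← hinv (i - 1), e])
      have c2 : f (i - 1) ≠ i + 1 := fun e => by rw [← e, hinv] at e1; omega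
      have e3 := hT (i - 1) (by omega) (by omega) (by omega) c1 c2
      refine hnc (f i) (i - 1) (by omega) (by omega) ?_ (by omega)
      rw [hfa, e3]
      unfold skip unskip; split_ifs <;> omega
    refine ⟨by omega, NC2.ext fun y hy => ?_⟩
    rw [hcup _ _ y hy, hf]
    by_cases y1 : y = i - 1
    · rw [if_pos y1, y1, ← e2, hfa]; omega
    by_cases y2 : y = i - 1 + 1
    · rw [if_neg y1, if_pos y2, ← e2]
      congr 1
      omega
    rw [if_neg y1, if_neg y2]
    by_cases y3 : y = i + 1
    · rw [y3, e1]
      unfold skip unskip; split_ifs <;> omega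
    by_cases y4 : y = f (i + 1)
    · rw [y4, hfb, e1]
      unfold skip unskip; split_ifs <;> omega
    rw [hT y hy (by omega) y3 (fun e => y1 (by rw [← hinv y, e, e2]))
      (fun e => y4 (by rw [← e, hinv]))]
    unfold skip unskip; split_ifs <;> omega
  · left
    have hbg : i + 1 < f (i + 1) := by
      by_contra hc
      exact hnc (f (i + 1)) i (by omega) (by omega) (by omega) (by omega)
    have hba : f (i + 1) < f i := by
      by_contra hc
      have : f i ≠ f (i + 1) := fun e => by have := hinj _ _ e; omega
      exact hnc i (i + 1) (by omega) (by omega) (by omega) (by omega)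
    have hTb := hcap (f (i + 1)) hlb hbi hb0
    rw [glueFun, hfb, if_neg (by omega), if_pos rfl] at hTb
    have hbi' : ¬ 2 * k + 1 - f (i + 1) < i := by
      intro hc
      have : f i = 2 * k + 1 - f (i + 1) := by
        rw [hTb]; unfold skip unskip; split_ifs <;> omega
      omega
    have e1 : f i = 2 * k + 3 - f (i + 1) := by
      rw [hTb]; unfold skip unskip; split_ifs <;> omega
    have hik : i < k := by omega
    have e2 : f (i + 1) = i + 2 := by
      by_contra hc
      have c1 : f (i + 2) ≠ i := fun e => by have := hinv (i + 2); rw [e] at this; omega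
      have c2 : f (i + 2) ≠ i + 1 := fun e => hc (by rw [← hinv (i + 2), e])
      have e3 := hT (i + 2) (by omega) (by omega) (by omega) c1 c2
      refine hnc i (i + 2) (by omega) (by omega) ?_ (by omega)
      rw [e3, e1]
      unfold skip unskip; split_ifs <;> omega
    refine ⟨hik, NC2.ext fun y hy => ?_⟩
    rw [hcup _ _ y hy, hf]
    by_cases y1 : y = i + 1
    · rw [if_pos y1, y1, e2]
    by_cases y2 : y = i + 1 + 1
    · rw [if_neg y1, if_pos y2, y2, show i + 1 + 1 = i + 2 from rfl, ← e2, hfb]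
    rw [if_neg y1, if_neg y2]
    by_cases y3 : y = i
    · rw [y3, e1]
      unfold skip unskip; split_ifs <;> omega
    by_cases y4 : y = f i
    · rw [y4, hfa, e1]
      unfold skip unskip; split_ifs <;> omega
    rw [hT y hy y3 y1 (fun e => y4 (by rw [← e, hinv]))
      (fun e => y2 (by rw [← hinv y, e, e2]))]
    unfold skip unskip; split_ifs <;> omega

/-! ### Parity -/

theorem partner_parity {k : ℕ} (p : NC2 k) {x : ℕ} (hx : x < 2 * k) :
    (partner p x + x) % 2 = 1 := by
  induction k generalizing x with
  | zero => omega
  | succ k ih =>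
    obtain ⟨i, hi, r, rfl⟩ := exists_eq_cup p
    by_cases h1 : x = i
    · rw [h1, partner_cup_left]; omega
    by_cases h2 : x = i + 1
    · rw [h2, partner_cup_right]; omega
    obtain ⟨x, rfl⟩ := exists_skip h1 h2
    rw [skip_lt hi] at hx
    have := ih r hx
    rw [partner_cup_skip]
    unfold skip
    split_ifs <;> omega

/-- The sign of a non-crossing pairing: the parity of the number of odd left ends of pairs. -/
def sign {k : ℕ} (p : NC2 k) : ℤ :=
  ∏ x ∈ Finset.range (2 * k), if x < partner p x then (-1) ^ x else 1

theorem prod_range_skip {k i : ℕ} (hi : i ≤ 2 * k) (F : ℕ → ℤ) :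
    ∏ y ∈ Finset.range (2 * (k + 1)), F y =
      F i * F (i + 1) * ∏ x ∈ Finset.range (2 * k), F (skip i x) := by
  rw [← Finset.mul_prod_erase _ _ (Finset.mem_range.2 (by omega : i < 2 * (k + 1))),
    ← Finset.mul_prod_erase _ _ (Finset.mem_erase.2 ⟨by omega, Finset.mem_range.2
      (by omega : i + 1 < 2 * (k + 1))⟩), mul_assoc]
  congr 2
  symm
  refine Finset.prod_bij (fun x _ => skip i x) ?_ ?_ ?_ ?_
  · intro x hx
    have := skip_ne i x
    simp only [Finset.mem_erase, Finset.mem_range, skip_lt hi] at hx ⊢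
    exact ⟨this.2, this.1, hx⟩
  · intro x _ y _ h
    exact skip_inj.1 h
  · intro y hy
    simp only [Finset.mem_erase, Finset.mem_range] at hy
    obtain ⟨x, rfl⟩ := exists_skip hy.2.1 hy.1
    exact ⟨x, Finset.mem_range.2 ((skip_lt hi).1 hy.2.2), rfl⟩
  · intro x _
    rfl

theorem neg_one_pow_skip (i x : ℕ) : (-1 : ℤ) ^ skip i x = (-1) ^ x := by
  unfold skip; split_ifs <;> simp [pow_add]

theorem sign_cup {k i : ℕ} (hi : i ≤ 2 * k) (p : NC2 k) :
    sign (cup i hi p) = (-1) ^ i * sign p := by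
  unfold sign
  rw [prod_range_skip hi, partner_cup_left, partner_cup_right, if_pos (by omega),
    if_neg (by omega), mul_one]
  congr 1
  refine Finset.prod_congr rfl fun x _ => ?_
  simp only [partner_cup_skip, skip_lt_skip, neg_one_pow_skip]

theorem sign_sq {k : ℕ} (p : NC2 k) : sign p * sign p = 1 := by
  unfold sign
  rw [← Finset.prod_mul_distrib]
  refine Finset.prod_eq_one fun x _ => ?_
  split_ifs
  · rw [← pow_add, ← two_mul, pow_mul]; simp
  · rfl

theorem neg_one_pow_eq_neg {a b : ℕ} (h : (a + b) % 2 = 1) : (-1 : ℤ) ^ a = -(-1) ^ b := by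
  have h1 : (-1 : ℤ) ^ (a + b) = -1 := Odd.neg_one_pow (Nat.odd_iff.2 h)
  have h2 : (-1 : ℤ) ^ b * (-1) ^ b = 1 := by rw [← mul_pow]; simp
  rw [pow_add] at h1
  linear_combination (-1 : ℤ) ^ b * h1 - (-1) ^ a * h2

/-- Here `e` is the sign of `i`, while `a` and `b` are the partners of `i` and `i + 1`. Non-crossing
leaves three relative positions, and in each the two strands together and the merged strand differ
by the same factor. -/
theorem sign_cap_aux (i a b : ℕ) (e c : ℤ) (sa : a < i ∨ i + 1 < a) (sb : b < i ∨ i + 1 < b)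
    (hab : a ≠ b) (n1 : a < b → b < i → False) (n2 : b < i → i + 1 < a → False)
    (n3 : i + 1 < a → a < b → False) :
    ((if i < a then e else 1) * if i + 1 < b then e * -1 else 1) *
      ((if a < i then -e else 1) * ((if b < i + 1 then e else 1) * c)) =
    -(e * ((if a < b then -e else 1) * ((if b < a then e else 1) * c))) := by
  rcases sa with sa | sa <;> rcases sb with sb | sb
  · have : b < a := by
      by_contra hc
      exact n1 (by omega) sb
    rw [if_neg (by omega), if_neg (by omega), if_pos sa, if_pos (by omega), if_neg (by omega),
      if_pos this]
    ring
  · rw [if_neg (by omega), if_pos sb, if_pos sa, if_neg (by omega), if_pos (by omega),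
      if_neg (by omega)]
    ring
  · exact (n2 sb sa).elim
  · have : b < a := by
      by_contra hc
      exact n3 sa (by omega)
    rw [if_pos (by omega), if_pos sb, if_neg (by omega), if_neg (by omega), if_neg (by omega),
      if_pos this]
    ring

/-- The cap merges the strands at `i` and `i + 1`, and all other strands keep the parity of their
left ends. By `partner_parity` the two outer ends have known parities, which leaves the case check
of `sign_cap_aux`. -/
theorem sign_cap {k i : ℕ} (hi : i ≤ 2 * k) (q : NC2 (k + 1)) (hq : partner q i ≠ i + 1) :
    sign q = -((-1) ^ i * sign (cap i hi q)) := by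
  have hinv := partner_partner q
  have ha0 : partner q i ≠ i := partner_ne q (by omega)
  have hb0 : partner q (i + 1) ≠ i + 1 := partner_ne q (by omega)
  have hb1 : partner q (i + 1) ≠ i := fun e => hq (by
    rw [← hinv (i + 1), e])
  have hla := partner_lt q (x := i) (by omega)
  have hlb := partner_lt q (x := i + 1) (by omega)
  have hpa := partner_parity q (x := i) (by omega)
  have hpb := partner_parity q (x := i + 1) (by omega)
  obtain ⟨a, ha⟩ := exists_skip ha0 hq
  obtain ⟨b, hb⟩ := exists_skip hb1 hb0
  have hab : a ≠ b := by
    rintro rfl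
    have := (hinv i).symm.trans ((congrArg _ (ha.trans hb.symm)).trans (hinv (i + 1)))
    omega
  have hfa : partner q (skip i a) = i := by rw [← ha, hinv]
  have hfb : partner q (skip i b) = i + 1 := by rw [← hb, hinv]
  have hca : partner (cap i hi q) a = b := by
    rw [← skip_inj (i := i), skip_partner_cap hi q ((skip_lt hi).1 (ha ▸ hla)), glueFun, hfa,
      if_pos rfl, hb]
  have hcb : partner (cap i hi q) b = a := by
    rw [← hca, partner_partner]
  have n1 := partner_noncrossing q (a := i) (b := i + 1)
  have n2 := partner_noncrossing q (a := skip i a) (b := skip i b)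
  have n3 := partner_noncrossing q (a := skip i b) (b := i)
  have ma : a ∈ Finset.range (2 * k) := Finset.mem_range.2 ((skip_lt hi).1 (ha ▸ hla))
  have mb : b ∈ (Finset.range (2 * k)).erase a :=
    Finset.mem_erase.2 ⟨hab.symm, Finset.mem_range.2 ((skip_lt hi).1 (hb ▸ hlb))⟩
  have rest : ∏ x ∈ ((Finset.range (2 * k)).erase a).erase b,
        (if skip i x < partner q (skip i x) then (-1 : ℤ) ^ skip i x else 1) =
      ∏ x ∈ ((Finset.range (2 * k)).erase a).erase b,
        (if x < partner (cap i hi q) x then (-1 : ℤ) ^ x else 1) := by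
    refine Finset.prod_congr rfl fun x hx => ?_
    simp only [Finset.mem_erase, Finset.mem_range] at hx
    have h1 : partner q (skip i x) ≠ i := fun e => hx.2.1 (by
      rw [← skip_inj (i := i), ← ha, ← hinv (skip i x), e])
    have h2 : partner q (skip i x) ≠ i + 1 := fun e => hx.1 (by
      rw [← skip_inj (i := i), ← hb, ← hinv (skip i x), e])
    have := skip_partner_cap hi q hx.2.2
    rw [glueFun, if_neg h1, if_neg h2] at this
    simp only [← this, skip_lt_skip, neg_one_pow_skip]
  unfold sign
  rw [prod_range_skip hi, ← Finset.mul_prod_erase _ _ ma, ← Finset.mul_prod_erase _ _ mb,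
    rest, ← Finset.mul_prod_erase _ _ ma, ← Finset.mul_prod_erase _ _ mb, hfa, hfb, hca, hcb]
  generalize (∏ x ∈ ((Finset.range (2 * k)).erase a).erase b,
        (if x < partner (cap i hi q) x then (-1 : ℤ) ^ x else 1)) = c
  rw [ha] at hpa hla ha0 hq
  rw [hb] at hpb hlb hb0 hb1
  rw [ha, hb] at n1
  rw [hfa, hfb] at n2
  rw [hfb, ha] at n3
  rw [ha, hb, neg_one_pow_skip, neg_one_pow_skip]
  have pa : (-1 : ℤ) ^ a = -(-1) ^ i := by
    rw [← neg_one_pow_skip i a]; exact neg_one_pow_eq_neg hpa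
  have pb : (-1 : ℤ) ^ b = (-1) ^ i := by
    rw [← neg_one_pow_skip i b, neg_one_pow_eq_neg hpb, pow_succ]; ring
  rw [pa, pb, pow_succ]
  have sab : (a < b ↔ skip i a < skip i b) := skip_lt_skip.symm
  have sba : (b < a ↔ skip i b < skip i a) := skip_lt_skip.symm
  simp only [sab, sba]
  exact sign_cap_aux _ _ _ _ _ (skip_lt_or_lt i a) (skip_lt_or_lt i b)
    (fun h => hab (skip_inj.1 h)) (fun h h' => n2 h h' (Nat.lt_succ_self i) hlb)
    (fun h h' => n3 h (Nat.lt_succ_self i) h' (by omega))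
    (fun h h' => n1 (Nat.lt_succ_self i) h h' (by omega))

/-- Removing a cup from `p` changes both sides by the same sign, whether or not a loop closes. Hence
positive and negative loop parameters differ by a diagonal change of signs. -/
theorem neg_one_pow_loops {k : ℕ} (p q : NC2 k) :
    (-1 : ℤ) ^ (k + loops p q) = sign p * sign q := by
  induction k with
  | zero =>
    have : IsEmpty (Quot fun i j => j = p.1 i ∨ j = q.1 i) :=
      ⟨fun x => by
        obtain ⟨i, -⟩ := Quot.exists_rep x
        exact absurd i.2 (by omega)⟩
    simp [loops, sign]
  | succ k ih =>
    obtain ⟨i, hi, r, rfl⟩ := exists_eq_cup p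
    have h2 : ((-1 : ℤ) ^ i) ^ 2 = 1 := by rw [← pow_mul, mul_comm, pow_mul]; simp
    have := ih r (cap i hi q)
    rw [loops_cup, sign_cup]
    split_ifs with h
    · rw [← cup_cap hi h, cap_cup, sign_cup, show k + 1 + (1 + loops r (cap i hi q)) =
        (k + loops r (cap i hi q)) + 2 by ring, pow_add, this]
      linear_combination -sign r * sign (cap i hi q) * h2
    · rw [sign_cap hi q h, show k + 1 + (0 + loops r (cap i hi q)) =
        (k + loops r (cap i hi q)) + 1 by ring, pow_add, this]
      linear_combination sign r * sign (cap i hi q) * h2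

open Filter Topology

/-! ### The Gram matrix -/

/-- The Gram matrix of the diagrams at the loop parameter `-δ`, up to the sign `(-1) ^ k`. -/
noncomputable def gram (k : ℕ) (δ : ℝ) : Matrix (NC2 k) (NC2 k) ℝ :=
  Matrix.of fun p q => (-1) ^ k * (-δ) ^ loops p q

/-- The normalisation of `gram` is chosen for this sign pattern: the passage from `k` to `k + 1`
contributes -1, and a closed loop a further -δ. The weight is thus positive on the pairing that
contains the cup and negative on all others. -/
theorem gram_cup {k i : ℕ} (hi : i ≤ 2 * k) (δ : ℝ) (s : NC2 k) (q : NC2 (k + 1)) :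
    gram (k + 1) δ (cup i hi s) q =
      (if q = cup i hi (cap i hi q) then δ else -1) * gram k δ s (cap i hi q) := by
  simp only [gram, Matrix.of_apply, loops_cup, partner_eq_succ_iff hi, eq_comm (a := q)]
  split_ifs
  · rw [pow_add, pow_succ]; ring
  · rw [zero_add, pow_succ]; ring

/-- The pairings other than `cup i r` that become `r` when the points `i` and `i + 1` are joined. -/
def neighbours {k : ℕ} (i : ℕ) (hi : i ≤ 2 * k) (r : NC2 k) : Finset (NC2 (k + 1)) :=
  {q | cap i hi q = r ∧ q ≠ cup i hi r}

theorem sum_cap {k i : ℕ} (hi : i ≤ 2 * k) (δ : ℝ) (r : NC2 k) (x : NC2 (k + 1) → ℝ) :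
    ∑ q with cap i hi q = r, (if q = cup i hi (cap i hi q) then δ else -1) * x q =
      δ * x (cup i hi r) - ∑ q ∈ neighbours i hi r, x q := by
  have e : (Finset.univ.filter fun q => cap i hi q = r) =
      insert (cup i hi r) (neighbours i hi r) := by
    ext q
    simp only [neighbours, Finset.mem_filter, Finset.mem_univ, true_and, Finset.mem_insert]
    constructor
    · intro h
      by_cases hq : q = cup i hi r
      · exact Or.inl hq
      · exact Or.inr ⟨h, hq⟩
    · rintro (rfl | h)
      · exact cap_cup hi r
      · exact h.1
  rw [e, Finset.sum_insert (by simp [neighbours]), cap_cup, if_pos rfl, sub_eq_add_neg,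
    ← Finset.sum_neg_distrib]
  congr 1
  refine Finset.sum_congr rfl fun q hq => ?_
  simp only [neighbours, Finset.mem_filter, Finset.mem_univ, true_and] at hq
  rw [if_neg (by rw [hq.1]; exact hq.2)]
  ring

/-- Joining neighbouring points is adjoint to inserting a pair of neighbouring points. -/
theorem gram_relation {k i : ℕ} (hi : i ≤ 2 * k) {δ : ℝ} (h : IsUnit (gram k δ).det)
    (r : NC2 k) (x : NC2 (k + 1) → ℝ) :
    δ * x (cup i hi r) = ∑ q ∈ neighbours i hi r, x q +
      ∑ s, (gram k δ)⁻¹ r s * (gram (k + 1) δ).mulVec x (cup i hi s) := by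
  -- The weighted push-forward of `x` along the cap; by `gram_cup` the rows of the large system
  -- indexed by cups form the small system for `y`.
  let y : NC2 k → ℝ := fun r =>
    ∑ q with cap i hi q = r, (if q = cup i hi (cap i hi q) then δ else -1) * x q
  have hy : (gram k δ).mulVec y = fun s => (gram (k + 1) δ).mulVec x (cup i hi s) := by
    funext s
    simp only [Matrix.mulVec, dotProduct, gram_cup]
    rw [← Finset.sum_fiberwise Finset.univ (cap i hi)]
    refine Finset.sum_congr rfl fun r _ => ?_
    rw [Finset.mul_sum]
    refine Finset.sum_congr rfl fun q hq => ?_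
    rw [(Finset.mem_filter.1 hq).2]
    ring
  have hy' : y r = ∑ s, (gram k δ)⁻¹ r s * (gram (k + 1) δ).mulVec x (cup i hi s) := by
    have := congrFun (congrArg (gram k δ)⁻¹.mulVec hy) r
    rw [Matrix.mulVec_mulVec, Matrix.nonsing_inv_mul _ h, Matrix.one_mulVec] at this
    rw [this]
    rfl
  have hyr : y r = δ * x (cup i hi r) - ∑ q ∈ neighbours i hi r, x q := sum_cap hi δ r x
  rw [← hy', hyr]
  ring

/-! ### Propagation of positivity, and large loop parameters. -/

theorem gram_mulVec_inv {k : ℕ} {δ : ℝ} (h : IsUnit (gram k δ).det) (p : NC2 k) :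
    (gram k δ).mulVec (fun q => (gram k δ)⁻¹ q p) = fun q => if q = p then 1 else 0 := by
  funext q
  have := congrFun (congrFun (Matrix.mul_nonsing_inv _ h) q) p
  rw [Matrix.one_apply] at this
  rw [← this]
  rfl

/-- The Gram matrix is invertible, and the entries of the inverse are non-negative. -/
def HasNonnegInverse (k : ℕ) (δ : ℝ) : Prop :=
  IsUnit (gram k δ).det ∧ ∀ p q, 0 ≤ (gram k δ)⁻¹ p q

/-- A Harnack inequality: `q` is one of the neighbours in `gram_relation`, and every other term
there is non-negative. -/
theorem le_mul_cup_cap {k i : ℕ} (hi : i ≤ 2 * k) {δ : ℝ} (h : HasNonnegInverse k δ)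
    {x : NC2 (k + 1) → ℝ} (hx : ∀ q, 0 ≤ x q) (hy : ∀ q, 0 ≤ (gram (k + 1) δ).mulVec x q)
    (q : NC2 (k + 1)) (hq : q ≠ cup i hi (cap i hi q)) :
    x q ≤ δ * x (cup i hi (cap i hi q)) := by
  rw [gram_relation hi h.1]
  have h1 : x q ≤ ∑ q ∈ neighbours i hi (cap i hi q), x q :=
    Finset.single_le_sum (f := x) (fun q _ => hx q) (by simp [neighbours, hq])
  have h2 : 0 ≤ ∑ s, (gram k δ)⁻¹ (cap i hi q) s * (gram (k + 1) δ).mulVec x (cup i hi s) :=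
    Finset.sum_nonneg fun s _ => mul_nonneg (h.2 _ _) (hy _)
  linarith

/-- A column of the inverse is not zero, so it has a positive entry, and the Harnack inequality
carries positivity along the cup-cap moves to every other entry. -/
theorem inv_gram_pos {k : ℕ} {δ : ℝ} (hδ : 0 < δ) (h : HasNonnegInverse k δ)
    (h' : HasNonnegInverse (k + 1) δ) (p q : NC2 (k + 1)) : 0 < (gram (k + 1) δ)⁻¹ q p := by
  have hy := gram_mulVec_inv h'.1 p
  refine mem_of_closed {q | 0 < (gram (k + 1) δ)⁻¹ q p} ?_ ?_ q
  · by_contra hc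
    have h0 : (fun q => (gram (k + 1) δ)⁻¹ q p) = 0 := by
      funext q
      refine le_antisymm (not_lt.1 fun hq => hc ⟨q, hq⟩) (h'.2 _ _)
    rw [h0, Matrix.mulVec_zero] at hy
    simpa using congrFun hy p
  · intro i hi q hq
    by_cases hqc : q = cup i hi (cap i hi q)
    · rwa [← hqc]
    have := le_mul_cup_cap hi h (x := fun q => (gram (k + 1) δ)⁻¹ q p) (fun q => h'.2 q p)
      (fun q => by rw [hy]; positivity) q hqc
    exact pos_of_mul_pos_right (lt_of_lt_of_le hq this) hδ.le

/-- The maximum principle for large loop parameters. -/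
theorem nonneg_of_gram_mulVec_nonneg {k : ℕ} {δ : ℝ} (hδ : Fintype.card (NC2 (k + 1)) < δ)
    (h : HasNonnegInverse k δ) {x : NC2 (k + 1) → ℝ}
    (hy : ∀ q, 0 ≤ (gram (k + 1) δ).mulVec x q) (q : NC2 (k + 1)) : 0 ≤ x q := by
  obtain ⟨m, -, hm⟩ := Finset.exists_min_image Finset.univ x ⟨q, Finset.mem_univ q⟩
  refine le_trans ?_ (hm q (Finset.mem_univ q))
  -- Every pairing contains a cup, so the relation is available at the minimiser. A negative minimum
  -- would be at least card/δ times itself with card < δ, which is absurd.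
  obtain ⟨i, hi, r, rfl⟩ := exists_eq_cup m
  by_contra hc
  push Not at hc
  have e := gram_relation hi h.1 r x
  have h2 : 0 ≤ ∑ s, (gram k δ)⁻¹ r s * (gram (k + 1) δ).mulVec x (cup i hi s) :=
    Finset.sum_nonneg fun s _ => mul_nonneg (h.2 _ _) (hy _)
  have h3 := Finset.card_nsmul_le_sum (neighbours i hi r) x _
    (fun q _ => hm q (Finset.mem_univ q))
  have h4 : ((neighbours i hi r).card : ℝ) ≤ Fintype.card (NC2 (k + 1)) := by
    exact_mod_cast Finset.card_le_univ _
  rw [nsmul_eq_mul] at h3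
  nlinarith

theorem isUnit_det_gram {k : ℕ} {δ : ℝ} (h : ∀ x, (gram k δ).mulVec x = 0 → x = 0) :
    IsUnit (gram k δ).det := by
  rw [isUnit_iff_ne_zero]
  intro h0
  obtain ⟨v, hv, hv'⟩ := Matrix.exists_mulVec_eq_zero_iff.2 h0
  exact hv (h v hv')

/-- The maximum principle applied to a kernel vector and to its negative gives injectivity; applied
to the columns of the inverse it gives the signs. -/
theorem hasNonnegInverse_of_large {k : ℕ} {δ : ℝ} (hδ : Fintype.card (NC2 (k + 1)) < δ)
    (h : HasNonnegInverse k δ) : HasNonnegInverse (k + 1) δ := by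
  have hu : IsUnit (gram (k + 1) δ).det := by
    refine isUnit_det_gram fun x hx => funext fun q => le_antisymm ?_ ?_
    · have := nonneg_of_gram_mulVec_nonneg hδ h (x := -x)
        (fun q => by rw [Matrix.mulVec_neg, hx]; simp) q
      simpa using this
    · exact nonneg_of_gram_mulVec_nonneg hδ h (fun q => by rw [hx]; simp) q
  refine ⟨hu, fun p q => ?_⟩
  refine nonneg_of_gram_mulVec_nonneg hδ h (x := fun p => (gram (k + 1) δ)⁻¹ p q) (fun p => ?_) p
  rw [gram_mulVec_inv hu]
  positivity

/-! ### The a priori bound -/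

/-- Pairing the inequalities with the Perron-Frobenius vector sin((j+1)π/(k+2)) of the path with k +
1 vertices replaces the adjacency operator by its eigenvalue 2cos(π/(k+2)). -/
theorem path_sum_le (k : ℕ) (a v : ℕ → ℝ) (δ : ℝ)
    (h : ∀ j ≤ k, δ * a j ≤ (if j < k then a (j + 1) else 0) + (if 0 < j then a (j - 1) else 0) +
      v j) :
    (δ - 2 * Real.cos (Real.pi / (k + 2))) *
        ∑ j ∈ Finset.range (k + 1), Real.sin ((j + 1) * (Real.pi / (k + 2))) * a j ≤
      ∑ j ∈ Finset.range (k + 1), Real.sin ((j + 1) * (Real.pi / (k + 2))) * v j := by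
  set θ := Real.pi / (k + 2) with hθ
  let S : ℕ → ℝ := fun m => Real.sin (m * θ)
  have hS : ∀ j : ℕ, Real.sin ((j + 1) * θ) = S (j + 1) := fun j => by simp [S]
  have hk : ((k : ℝ) + 2) ≠ 0 := by positivity
  have hθ0 : 0 ≤ θ := by positivity
  -- `S` vanishes just outside both ends of the path, which absorbs the boundary terms of the index
  -- shifts `h1` and `h2`.
  have hSk : S (k + 2) = 0 := by
    have : ((k + 2 : ℕ) : ℝ) * θ = Real.pi := by
      rw [hθ]; push_cast; field_simp
    simp only [S, this, Real.sin_pi]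
  have hS0 : S 0 = 0 := by simp [S]
  have hSn : ∀ j ≤ k, 0 ≤ S (j + 1) := by
    intro j hj
    refine Real.sin_nonneg_of_nonneg_of_le_pi (by positivity) ?_
    rw [hθ, mul_div_assoc', div_le_iff₀ (by positivity), mul_comm]
    refine mul_le_mul_of_nonneg_left ?_ Real.pi_pos.le
    have : (j : ℝ) ≤ k := by exact_mod_cast hj
    push_cast
    linarith
  have hrec : ∀ j, S j + S (j + 2) = 2 * Real.cos θ * S (j + 1) := by
    intro j
    have e1 : ((j : ℕ) : ℝ) * θ = ((j + 1 : ℕ) : ℝ) * θ - θ := by push_cast; ring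
    have e2 : ((j + 2 : ℕ) : ℝ) * θ = ((j + 1 : ℕ) : ℝ) * θ + θ := by push_cast; ring
    simp only [S]
    rw [e1, e2, Real.sin_add, Real.sin_sub]
    ring
  simp only [hS]
  have h1 : ∑ j ∈ Finset.range (k + 1), S (j + 1) * (if j < k then a (j + 1) else 0) =
      ∑ j ∈ Finset.range (k + 1), S j * a j := by
    rw [Finset.sum_range_succ, Finset.sum_range_succ' (fun j => S j * a j), hS0]
    simp only [lt_irrefl, if_false, mul_zero, zero_mul]
    congr 1
    exact Finset.sum_congr rfl fun j hj => by rw [if_pos (Finset.mem_range.1 hj)]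
  have h2 : ∑ j ∈ Finset.range (k + 1), S (j + 1) * (if 0 < j then a (j - 1) else 0) =
      ∑ j ∈ Finset.range (k + 1), S (j + 2) * a j := by
    rw [Finset.sum_range_succ', Finset.sum_range_succ (fun j => S (j + 2) * a j), hSk]
    simp
  have h3 : ∑ j ∈ Finset.range (k + 1), S (j + 1) * (δ * a j) ≤
      ∑ j ∈ Finset.range (k + 1), S (j + 1) * ((if j < k then a (j + 1) else 0) +
        (if 0 < j then a (j - 1) else 0) + v j) := by
    refine Finset.sum_le_sum fun j hj => ?_
    have hj : j ≤ k := Nat.lt_succ_iff.1 (Finset.mem_range.1 hj)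
    exact mul_le_mul_of_nonneg_left (h j hj) (hSn j hj)
  simp only [mul_add, Finset.sum_add_distrib] at h3
  rw [h1, h2, ← Finset.sum_add_distrib] at h3
  have h4 : ∑ j ∈ Finset.range (k + 1), (S j * a j + S (j + 2) * a j) =
      2 * Real.cos θ * ∑ j ∈ Finset.range (k + 1), S (j + 1) * a j := by
    rw [Finset.mul_sum]
    refine Finset.sum_congr rfl fun j _ => ?_
    rw [← add_mul, hrec]
    ring
  have h5 : ∑ j ∈ Finset.range (k + 1), S (j + 1) * (δ * a j) =
      δ * ∑ j ∈ Finset.range (k + 1), S (j + 1) * a j := by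
    rw [Finset.mul_sum]
    exact Finset.sum_congr rfl fun j _ => by ring
  rw [h4, h5] at h3
  linarith

/-- Only an upper bound is needed, so the classification of neighbours may be used as an inclusion,
and any overlap of the two candidates only helps. -/
theorem sum_neighbours_rainbow_le {k j : ℕ} (hj : j ≤ k) {x : NC2 (k + 1) → ℝ} {a : ℕ → ℝ}
    (hx : ∀ q, 0 ≤ x q) (ha : ∀ i (hi : i ≤ 2 * k), a i = x (cup i hi (rainbow k))) :
    ∑ q ∈ neighbours j (by omega) (rainbow k), x q ≤
      (if j < k then a (j + 1) else 0) + (if 0 < j then a (j - 1) else 0) := by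
  classical
  let A : Finset (NC2 (k + 1)) :=
    if h : j < k then {cup (j + 1) (by omega) (rainbow k)} else ∅
  let B : Finset (NC2 (k + 1)) :=
    if h : 0 < j then {cup (j - 1) (by omega) (rainbow k)} else ∅
  have hsub : neighbours j (by omega) (rainbow k) ⊆ A ∪ B := by
    intro q hq
    simp only [neighbours, Finset.mem_filter, Finset.mem_univ, true_and] at hq
    rw [Finset.mem_union]
    rcases eq_cup_rainbow_of_cap_eq hj q hq.1 hq.2 with ⟨h, e⟩ | ⟨h, e⟩
    · left
      simp only [A, dif_pos h, Finset.mem_singleton, e]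
    · right
      simp only [B, dif_pos h, Finset.mem_singleton, e]
  have hA : ∑ q ∈ A, x q = if j < k then a (j + 1) else 0 := by
    by_cases h : j < k
    · simp [A, h, ha (j + 1) (by omega)]
    · simp [A, h]
  have hB : ∑ q ∈ B, x q = if 0 < j then a (j - 1) else 0 := by
    by_cases h : 0 < j
    · simp [B, h, ha (j - 1) (by omega)]
    · simp [B, h]
  rw [← hA, ← hB]
  have := Finset.sum_union_inter (s₁ := A) (s₂ := B) (f := x)
  have h0 : 0 ≤ ∑ q ∈ A ∩ B, x q := Finset.sum_nonneg fun q _ => hx q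
  have h1 := Finset.sum_le_sum_of_subset_of_nonneg hsub (f := x) fun q _ _ => hx q
  linarith

/-- For a column of the inverse, Gx is a coordinate vector, so the source term in the path
inequality is at most a row sum of the inverse at level `k`. Keeping only the term j = 0 of the
weighted sum costs the factor sin(π/(k+2)). -/
theorem inv_gram_rainbow_le {k : ℕ} {δ : ℝ} (hδ : 2 * Real.cos (Real.pi / (k + 2)) < δ)
    (h : HasNonnegInverse k δ) (h' : HasNonnegInverse (k + 1) δ) (p : NC2 (k + 1)) :
    (gram (k + 1) δ)⁻¹ (cup 0 (Nat.zero_le _) (rainbow k)) p ≤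
      (k + 1) * (∑ s, (gram k δ)⁻¹ (rainbow k) s) /
        ((δ - 2 * Real.cos (Real.pi / (k + 2))) * Real.sin (Real.pi / (k + 2))) := by
  set x : NC2 (k + 1) → ℝ := fun q => (gram (k + 1) δ)⁻¹ q p with hxd
  set c := ∑ s, (gram k δ)⁻¹ (rainbow k) s with hc
  have hc0 : 0 ≤ c := Finset.sum_nonneg fun s _ => h.2 _ _
  let a : ℕ → ℝ := fun i => if hi : i ≤ 2 * k then x (cup i hi (rainbow k)) else 0
  have ha : ∀ i (hi : i ≤ 2 * k), a i = x (cup i hi (rainbow k)) := fun i hi => dif_pos hi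
  have hx : ∀ q, 0 ≤ x q := fun q => h'.2 q p
  have ha0 : ∀ i, 0 ≤ a i := by
    intro i
    by_cases hi : i ≤ 2 * k
    · rw [ha i hi]; exact hx _
    · simp [a, hi]
  have hp := path_sum_le k a (fun _ => c) δ (by
    intro j hj
    have e := gram_relation (i := j) (by omega) h.1 (rainbow k) x
    rw [gram_mulVec_inv h'.1] at e
    rw [ha j (by omega), e]
    refine add_le_add (sum_neighbours_rainbow_le hj hx ha) ?_
    refine Finset.sum_le_sum fun s _ => mul_le_of_le_one_right (h.2 _ _) ?_
    dsimp only
    split_ifs <;> norm_num)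
  set θ := Real.pi / (k + 2) with hθ
  have hk : ((k : ℝ) + 2) ≠ 0 := by positivity
  have hpi : ((k : ℝ) + 2) * θ = Real.pi := by rw [hθ]; field_simp
  have hθ0 : 0 < θ := by positivity
  have hsin : ∀ j : ℕ, j < k + 1 → 0 < Real.sin ((j + 1) * θ) := by
    intro j hj
    refine Real.sin_pos_of_pos_of_lt_pi (by positivity) ?_
    rw [← hpi]
    refine mul_lt_mul_of_pos_right ?_ hθ0
    have : (j : ℝ) + 1 ≤ k + 1 := by exact_mod_cast hj
    linarith
  have h1 : Real.sin θ * x (cup 0 (Nat.zero_le _) (rainbow k)) ≤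
      ∑ j ∈ Finset.range (k + 1), Real.sin ((j + 1) * θ) * a j := by
    have := Finset.single_le_sum (s := Finset.range (k + 1))
      (f := fun j : ℕ => Real.sin ((j + 1) * θ) * a j)
      (fun j hj => mul_nonneg (hsin j (Finset.mem_range.1 hj)).le (ha0 j))
      (Finset.mem_range.2 (Nat.succ_pos k))
    simpa [ha 0 (Nat.zero_le _)] using this
  have h2 : ∑ j ∈ Finset.range (k + 1), Real.sin ((j + 1) * θ) * c ≤ (k + 1) * c := by
    have := Finset.sum_le_card_nsmul (Finset.range (k + 1))
      (fun j : ℕ => Real.sin ((j + 1) * θ) * c) c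
      (fun j _ => mul_le_of_le_one_left hc0 (Real.sin_le_one _))
    simpa using this
  have hs0 : 0 < Real.sin θ := by simpa using hsin 0 (Nat.succ_pos k)
  have hd : 0 < δ - 2 * Real.cos θ := by linarith
  rw [le_div_iff₀ (by positivity)]
  calc x (cup 0 (Nat.zero_le _) (rainbow k)) * ((δ - 2 * Real.cos θ) * Real.sin θ)
      = (δ - 2 * Real.cos θ) * (Real.sin θ * x (cup 0 (Nat.zero_le _) (rainbow k))) := by ring
    _ ≤ _ := mul_le_mul_of_nonneg_left h1 hd.le
    _ ≤ _ := hp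
    _ ≤ _ := h2

/-! ### Positivity of the inverse Gram matrix -/

theorem continuous_gram (k : ℕ) : Continuous (gram k) := by
  refine continuous_pi fun p => continuous_pi fun q => ?_
  simp only [gram, Matrix.of_apply]
  fun_prop

theorem continuousAt_inv_gram {k : ℕ} {δ : ℝ} (h : IsUnit (gram k δ).det) (p q : NC2 k) :
    ContinuousAt (fun δ => (gram k δ)⁻¹ p q) δ := by
  have e : ∀ δ, (gram k δ)⁻¹ p q = ((gram k δ).det)⁻¹ * (gram k δ).adjugate p q := by
    intro δ
    rw [Matrix.inv_def, Ring.inverse_eq_inv']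
    rfl
  simp only [e]
  refine ContinuousAt.mul (ContinuousAt.inv₀ ?_ h.ne_zero) ?_
  · exact (continuous_gram k).matrix_det.continuousAt
  · exact ((continuous_gram k).matrix_adjugate.matrix_elem p q).continuousAt

theorem two_cos_mono (k : ℕ) :
    2 * Real.cos (Real.pi / (k + 1)) ≤ 2 * Real.cos (Real.pi / (k + 2)) := by
  refine mul_le_mul_of_nonneg_left ?_ (by norm_num)
  refine Real.cos_le_cos_of_nonneg_of_le_pi (by positivity) ?_ ?_
  · exact div_le_self Real.pi_pos.le (by linarith [(Nat.cast_nonneg k : (0 : ℝ) ≤ k)])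
  · exact div_le_div_of_nonneg_left Real.pi_pos.le (by positivity) (by linarith)

theorem two_cos_nonneg (k : ℕ) : 0 ≤ 2 * Real.cos (Real.pi / (k + 2)) := by
  refine mul_nonneg (by norm_num) (Real.cos_nonneg_of_neg_pi_div_two_le_of_le ?_ ?_)
  · have : 0 ≤ Real.pi / (k + 2) := by positivity
    linarith [Real.pi_pos]
  · exact div_le_div_of_nonneg_left Real.pi_pos.le (by norm_num) (by linarith
      [(Nat.cast_nonneg k : (0 : ℝ) ≤ k)])

/-- The inverse of the Gram matrix stays bounded along the loop parameters where it is
non-negative. -/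
theorem hasNonnegInverse_of_frequently {k : ℕ} {δ₀ : ℝ}
    (hδ₀ : 2 * Real.cos (Real.pi / (k + 2)) < δ₀)
    (hk : ∀ δ, 2 * Real.cos (Real.pi / (k + 2)) < δ → HasNonnegInverse k δ)
    {G : Set ℝ} (hG : ∀ δ ∈ G, 2 * Real.cos (Real.pi / (k + 2)) < δ ∧ HasNonnegInverse (k + 1) δ)
    (hcl : δ₀ ∈ closure G) : HasNonnegInverse (k + 1) δ₀ := by
  have hne : (𝓝[G] δ₀).NeBot := mem_closure_iff_nhdsWithin_neBot.1 hcl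
  have hGm : ∀ᶠ δ in 𝓝[G] δ₀, δ ∈ G := self_mem_nhdsWithin
  -- By the Harnack inequality a bound for row `cup i (cap i q)` implies one for row `q`, so the
  -- unbounded rows are closed under the moves. If there were one, the row of `cup 0 (rainbow k)`
  -- would be unbounded too, against `inv_gram_rainbow_le`.
  have bdd : ∀ q, ∃ C, ∀ᶠ δ in 𝓝[G] δ₀, ∀ p, (gram (k + 1) δ)⁻¹ q p ≤ C := by
    by_contra hc
    push Not at hc
    have h0 := mem_of_closed {q | ¬ ∃ C, ∀ᶠ δ in 𝓝[G] δ₀, ∀ p, (gram (k + 1) δ)⁻¹ q p ≤ C} (by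
      obtain ⟨q, hq⟩ := hc
      refine ⟨q, fun ⟨C, hC⟩ => ?_⟩
      obtain ⟨δ, ⟨p, h1⟩, h2⟩ := ((hq C).and_eventually hC).exists
      exact absurd (h2 p) (not_le.2 h1)) (by
      rintro i hi q hq ⟨C, hC⟩
      refine hq ⟨max C ((δ₀ + 1) * C), ?_⟩
      have hlt : ∀ᶠ δ in 𝓝[G] δ₀, δ < δ₀ + 1 :=
        (eventually_lt_nhds (by linarith)).filter_mono nhdsWithin_le_nhds
      filter_upwards [hC, hGm, hlt] with δ hδ hm hlt p
      have hG' := hG δ hm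
      by_cases hqc : q = cup i hi (cap i hi q)
      · rw [hqc]
        exact (hδ p).trans (le_max_left _ _)
      · have := le_mul_cup_cap hi (hk δ hG'.1) (x := fun q => (gram (k + 1) δ)⁻¹ q p)
          (fun q => hG'.2.2 q p) (fun q => by rw [gram_mulVec_inv hG'.2.1]; positivity) q hqc
        refine this.trans (le_trans ?_ (le_max_right _ _))
        have h1 := hG'.2.2 (cup i hi (cap i hi q)) p
        have h2 := hδ p
        have h3 := two_cos_nonneg k
        exact mul_le_mul hlt.le h2 h1 (by linarith)) (cup 0 (Nat.zero_le _) (rainbow k))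
    refine h0 ?_
    have hθ : 0 < Real.sin (Real.pi / (k + 2)) := by
      refine Real.sin_pos_of_pos_of_lt_pi (by positivity) ?_
      exact div_lt_self Real.pi_pos (by linarith [(Nat.cast_nonneg k : (0 : ℝ) ≤ k)])
    let F : ℝ → ℝ := fun δ => (k + 1) * (∑ s, (gram k δ)⁻¹ (rainbow k) s) /
        ((δ - 2 * Real.cos (Real.pi / (k + 2))) * Real.sin (Real.pi / (k + 2)))
    have hcont : ContinuousAt F δ₀ := by
      refine ContinuousAt.div ?_ (by fun_prop) (mul_ne_zero (by linarith) hθ.ne')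
      refine continuousAt_const.mul (tendsto_finsetSum _ fun s _ => ?_)
      exact continuousAt_inv_gram (hk δ₀ hδ₀).1 _ _
    have hev := (hcont.eventually_lt_const (lt_add_one _)).filter_mono
      (nhdsWithin_le_nhds (s := G))
    refine ⟨F δ₀ + 1, ?_⟩
    filter_upwards [hev, hGm] with δ hδ hm p
    exact (inv_gram_rainbow_le (hG δ hm).1 (hk δ (hG δ hm).1) (hG δ hm).2 p).trans hδ.le
  have hu : IsUnit (gram (k + 1) δ₀).det := by
    refine isUnit_det_gram fun x hx => funext fun q => ?_
    obtain ⟨C, hC⟩ := bdd q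
    -- The bounded inverse controls `x` by the image of `x` uniformly in δ, so the estimate survives
    -- in the limit and excludes a kernel at δ₀.
    have hle : ∀ᶠ δ in 𝓝[G] δ₀, |x q| ≤ ∑ p, C * |(gram (k + 1) δ).mulVec x p| := by
      filter_upwards [hC, hGm] with δ hδ hm
      have e : x q = ∑ p, (gram (k + 1) δ)⁻¹ q p * (gram (k + 1) δ).mulVec x p := by
        have : (gram (k + 1) δ)⁻¹.mulVec ((gram (k + 1) δ).mulVec x) = x := by
          rw [Matrix.mulVec_mulVec, Matrix.nonsing_inv_mul _ (hG δ hm).2.1, Matrix.one_mulVec]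
        exact (congrFun this q).symm
      rw [e]
      refine (Finset.abs_sum_le_sum_abs _ _).trans (Finset.sum_le_sum fun p _ => ?_)
      rw [abs_mul, abs_of_nonneg ((hG δ hm).2.2 q p)]
      exact mul_le_mul_of_nonneg_right (hδ p) (abs_nonneg _)
    have hlim : Tendsto (fun δ => ∑ p, C * |(gram (k + 1) δ).mulVec x p|) (𝓝[G] δ₀)
        (𝓝 (∑ p, C * |(gram (k + 1) δ₀).mulVec x p|)) := by
      refine Tendsto.mono_left ?_ nhdsWithin_le_nhds
      have : Continuous fun δ => ∑ p, C * |(gram (k + 1) δ).mulVec x p| := by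
        refine continuous_finsetSum _ fun p _ => continuous_const.mul (Continuous.abs ?_)
        exact (continuous_apply p).comp ((continuous_gram (k + 1)).matrix_mulVec continuous_const)
      exact this.tendsto δ₀
    have := ge_of_tendsto hlim hle
    rw [hx] at this
    simpa using this
  refine ⟨hu, fun p q => ?_⟩
  refine ge_of_tendsto ((continuousAt_inv_gram hu p q).tendsto.mono_left
    (nhdsWithin_le_nhds (s := G))) ?_
  filter_upwards [hGm] with δ hm using (hG δ hm).2.2 p q

/-- The Gram matrix is invertible and all entries of its inverse are positive. -/
theorem inv_gram_pos_of_lt {k : ℕ} {δ : ℝ} (hδ : 2 * Real.cos (Real.pi / (k + 1)) < δ) :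
    IsUnit (gram k δ).det ∧ ∀ p q, 0 < (gram k δ)⁻¹ p q := by
  induction k generalizing δ with
  | zero =>
    have e : gram 0 δ = 1 := by
      ext p q
      have : IsEmpty (Quot fun i j => j = p.1 i ∨ j = q.1 i) :=
        ⟨fun x => by
          obtain ⟨i, -⟩ := Quot.exists_rep x
          exact absurd i.2 (by omega)⟩
      rw [NC2.subsingleton_zero.elim p q, Matrix.one_apply_eq]
      rw [NC2.subsingleton_zero.elim p q] at this
      simp [gram, loops]
    rw [e]
    refine ⟨by simp, fun p q => ?_⟩
    rw [NC2.subsingleton_zero.elim p q, inv_one, Matrix.one_apply_eq]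
    exact one_pos
  | succ k ih =>
    have e2 : ((k + 1 : ℕ) : ℝ) + 1 = k + 2 := by push_cast; ring
    rw [e2] at hδ
    have hk : ∀ δ, 2 * Real.cos (Real.pi / (k + 2)) < δ → HasNonnegInverse k δ := fun δ h => by
      have := ih (lt_of_le_of_lt (two_cos_mono k) h)
      exact ⟨this.1, fun p q => (this.2 p q).le⟩
    have hpos := two_cos_nonneg k
    let G : Set ℝ := {δ | 2 * Real.cos (Real.pi / (k + 2)) < δ ∧ HasNonnegInverse (k + 1) δ}
    -- Non-negativity is not an open condition, but on `G` it improves itself to strict positivity,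
    -- which is.
    have hGo : IsOpen G := by
      rw [isOpen_iff_mem_nhds]
      rintro δ ⟨h1, h2⟩
      have hp := inv_gram_pos (lt_of_le_of_lt hpos h1) (hk δ h1) h2
      have ev1 : ∀ᶠ δ in 𝓝 δ, (gram (k + 1) δ).det ≠ 0 :=
        (continuous_gram (k + 1)).matrix_det.continuousAt.eventually_ne h2.1.ne_zero
      have ev2 : ∀ᶠ δ in 𝓝 δ, ∀ p q, 0 < (gram (k + 1) δ)⁻¹ p q := by
        rw [eventually_all]
        intro p
        rw [eventually_all]
        intro q
        exact (continuousAt_inv_gram h2.1 p q).eventually_const_lt (hp q p)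
      filter_upwards [ev1, ev2, lt_mem_nhds h1] with δ h3 h4 h5
      exact ⟨h5, isUnit_iff_ne_zero.2 h3, fun p q => (h4 p q).le⟩
    have hsub : Set.Ioi (2 * Real.cos (Real.pi / (k + 2))) ⊆ G := by
      -- The half-line is connected, `G` meets it at a large parameter, and the a priori bound makes
      -- `G` closed in it.
      refine isPreconnected_Ioi.subset_of_closure_inter_subset hGo ?_ ?_
      · let δ₁ := max (2 * Real.cos (Real.pi / (k + 2))) (Fintype.card (NC2 (k + 1))) + 1
        have h1 : 2 * Real.cos (Real.pi / (k + 2)) < δ₁ := by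
          have := le_max_left (2 * Real.cos (Real.pi / (k + 2))) (Fintype.card (NC2 (k + 1)) : ℝ)
          simp only [δ₁]; linarith
        have h2 : Fintype.card (NC2 (k + 1)) < δ₁ := by
          have := le_max_right (2 * Real.cos (Real.pi / (k + 2))) (Fintype.card (NC2 (k + 1)) : ℝ)
          simp only [δ₁]; linarith
        exact ⟨δ₁, h1, h1, hasNonnegInverse_of_large h2 (hk δ₁ h1)⟩
      · rintro δ ⟨h1, h2⟩
        exact ⟨h2, hasNonnegInverse_of_frequently h2 hk (fun _ h => h) h1⟩
    have h' := (hsub hδ).2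
    exact ⟨h'.1, fun p q => inv_gram_pos (lt_of_le_of_lt hpos hδ) (hk δ hδ) h' q p⟩

/-! ### The bilinear form on diagrams -/

section algebra

variable {k : ℕ} {d : ℂ}

theorem mulMap_apply (x y : TL k d) : mulMap k d x y = x * y := rfl

theorem diagram_mul (p q : NC2 k) : diagramBasis k d p * diagramBasis k d q =
    d ^ stackLoops p q • diagramBasis k d (stack p q) := by
  change mulMap k d _ _ = _
  rw [mulMap, Module.Basis.constr_basis, Module.Basis.constr_basis]

theorem form_diagram (p q : NC2 k) :
    form k d (diagramBasis k d p) (diagramBasis k d q) = d ^ loops p q := by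
  rw [form_apply, transpose, Module.Basis.constr_basis, diagram_mul, map_smul, markovTrace,
    Module.Basis.constr_basis, smul_eq_mul, ← pow_add, stackLoops_flip_add_closureLoops]

theorem form_isSymm (k : ℕ) (d : ℂ) : (form k d).IsSymm :=
  LinearMap.BilinForm.isSymm_iff_basis (diagramBasis k d) |>.2 fun p q => by
    rw [form_diagram, form_diagram, loops_comm]

/-- Left multiplication by a diagram is adjoint to left multiplication by the diagram upside down.
It suffices to check basis vectors, where the loop counts agree by `stackLoops_add_loops_left`. -/
theorem form_diagram_mul (t q : NC2 k) (x : TL k d) :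
    form k d (diagramBasis k d t) (diagramBasis k d q * x) =
      d ^ stackLoops (flip q) t * form k d (diagramBasis k d (stack (flip q) t)) x := by
  have h : (form k d (diagramBasis k d t)).comp (mulMap k d (diagramBasis k d q)) =
      d ^ stackLoops (flip q) t • form k d (diagramBasis k d (stack (flip q) t)) := by
    refine (diagramBasis k d).ext fun y => ?_
    rw [LinearMap.comp_apply, LinearMap.smul_apply, mulMap_apply, diagram_mul, map_smul,
      form_diagram, form_diagram, smul_eq_mul, smul_eq_mul, ← pow_add, ← pow_add, loops_comm,
      stackLoops_add_loops_left]
  exact LinearMap.congr_fun h x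

theorem form_mul_diagram (t y : NC2 k) (x : TL k d) :
    form k d (diagramBasis k d t) (x * diagramBasis k d y) =
      d ^ stackLoops t (flip y) * form k d (diagramBasis k d (stack t (flip y))) x := by
  have h : (form k d (diagramBasis k d t)).comp ((mulMap k d).flip (diagramBasis k d y)) =
      d ^ stackLoops t (flip y) • form k d (diagramBasis k d (stack t (flip y))) := by
    refine (diagramBasis k d).ext fun q => ?_
    rw [LinearMap.comp_apply, LinearMap.smul_apply, LinearMap.flip_apply, mulMap_apply,
      diagram_mul, map_smul, form_diagram, form_diagram, smul_eq_mul, smul_eq_mul, ← pow_add,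
      ← pow_add, loops_comm, stackLoops_add_loops_right]
  exact LinearMap.congr_fun h x

theorem eq_of_form_diagram (h : (form k d).Nondegenerate) {x y : TL k d}
    (hxy : ∀ t, form k d (diagramBasis k d t) x = form k d (diagramBasis k d t) y) : x = y := by
  rw [← sub_eq_zero]
  refine h.2 _ fun z => ?_
  have : (form k d).flip (x - y) = 0 := by
    refine (diagramBasis k d).ext fun t => ?_
    simp [hxy t]
  exact LinearMap.congr_fun this z

theorem loops_pos (hk : 1 ≤ k) (p q : NC2 k) : 0 < loops p q := by
  have : Nonempty (Quot fun i j => j = p.1 i ∨ j = q.1 i) :=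
    ⟨Quot.mk _ ⟨0, by omega⟩⟩
  exact Nat.card_pos

/-- For `k ≥ 1` any two pairings close at least one loop, so the form vanishes identically at 0. -/
theorem ne_zero_of_nondegenerate (hk : 1 ≤ k) (h : (form k d).Nondegenerate) : d ≠ 0 := by
  rintro rfl
  have h0 : diagramBasis k 0 (rainbow k) = 0 := eq_of_form_diagram h fun t => by
    rw [form_diagram, map_zero, zero_pow (loops_pos hk _ _).ne']
  exact (diagramBasis k 0).ne_zero _ h0

end algebra

/-! ### The identity diagram and diagrams with cups -/

theorem rainbow_apply {k : ℕ} (x : Fin (2 * k)) : (rainbow k).1 x = x.rev := by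
  apply Fin.ext
  rw [← partner_val, partner_rainbow x.2, Fin.val_rev]
  omega

/-- Without such a pair every bottom point is joined to the top, in reversed order by non-crossing.
An order-reversing injection between k points on each edge leaves only the identity diagram. -/
theorem exists_bottom_cup {k : ℕ} {q : NC2 k} (hq : q ≠ rainbow k) :
    ∃ a, k ≤ a ∧ a + 1 < 2 * k ∧ partner q a = a + 1 := by
  by_contra hc
  have hlt : ∀ a, k ≤ a → a < 2 * k → partner q a < k := by
    intro a h1 h2
    by_contra h3
    have h4 := partner_ne q h2
    have h5 := partner_lt q h2
    obtain h6 | h6 : a < partner q a ∨ partner q a < a := by omega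
    · obtain ⟨i, hi1, hi2, hi3⟩ := exists_partner_eq_succ q h6 h5 rfl
      exact hc ⟨i, by omega, by omega, hi3⟩
    · obtain ⟨i, hi1, hi2, hi3⟩ := exists_partner_eq_succ q h6 h2 (partner_partner q a)
      exact hc ⟨i, by omega, by omega, hi3⟩
  have hanti : ∀ a, k ≤ a → a + 1 < 2 * k → partner q (a + 1) < partner q a := by
    intro a h1 h2
    have h3 := hlt a h1 (by omega)
    have h4 := hlt (a + 1) (by omega) h2
    by_contra h5
    have h6 : partner q a ≠ partner q (a + 1) := fun e => by
      have := partner_partner q a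
      rw [e, partner_partner] at this
      omega
    have h7 := partner_partner q a
    have h8 := partner_partner q (a + 1)
    exact partner_noncrossing q (a := partner q a) (b := partner q (a + 1)) (by omega) (by omega)
      (by omega) (by omega)
  have hup : ∀ m, m < k → partner q (k + m) + m + 1 ≤ k := by
    intro m
    induction m with
    | zero =>
      intro h
      have := hlt k le_rfl (by omega)
      simpa using this
    | succ m ih =>
      intro h
      have h1 := ih (by omega)
      have h2 := hanti (k + m) (by omega) (by omega)
      rw [show k + (m + 1) = k + m + 1 from rfl]
      omega
  have hlow : ∀ m, m < k → m ≤ partner q (2 * k - 1 - m) := by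
    intro m
    induction m with
    | zero => intro _; exact Nat.zero_le _
    | succ m ih =>
      intro h
      have h1 := ih (by omega)
      have h2 := hanti (2 * k - 1 - (m + 1)) (by omega) (by omega)
      rw [show 2 * k - 1 - (m + 1) + 1 = 2 * k - 1 - m by omega] at h2
      omega
  have hbot : ∀ a, k ≤ a → a < 2 * k → partner q a = 2 * k - 1 - a := by
    intro a h1 h2
    have h3 := hup (a - k) (by omega)
    have h4 := hlow (2 * k - 1 - a) (by omega)
    rw [show k + (a - k) = a by omega] at h3
    rw [show 2 * k - 1 - (2 * k - 1 - a) = a by omega] at h4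
    omega
  refine hq (NC2.ext fun x hx => ?_)
  rw [partner_rainbow hx]
  rcases lt_or_ge x k with h | h
  · have h1 := hbot (2 * k - 1 - x) (by omega) (by omega)
    rw [show 2 * k - 1 - (2 * k - 1 - x) = x by omega] at h1
    rw [← h1, partner_partner, h1]
  · exact hbot x h hx

theorem flip_flip {k : ℕ} (p : NC2 k) : flip (flip p) = p :=
  Subtype.ext (funext fun i => by simp [flip_apply])

theorem flip_rainbow (k : ℕ) : flip (rainbow k) = rainbow k :=
  Subtype.ext (funext fun i => by simp [flip_apply, rainbow_apply])

theorem exists_top_pair {k : ℕ} {q : NC2 k} (hq : q ≠ rainbow k) :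
    ∃ i : Fin (2 * k), i.val < k ∧ (q.1 i).val < k := by
  have hq' : flip q ≠ rainbow k := fun h => hq (by rw [← flip_flip q, h, flip_rainbow])
  obtain ⟨a, h1, h2, h3⟩ := exists_bottom_cup hq'
  have h4 := partner_val (flip q) ⟨a, by omega⟩
  rw [h3, flip_apply, Fin.val_rev] at h4
  refine ⟨Fin.rev ⟨a, by omega⟩, ?_, ?_⟩
  · rw [Fin.val_rev]; simp only; omega
  · omega

theorem generator_val {k : ℕ} (i : Fin (k - 1)) (x : Fin (2 * k)) :
    ((generator i).1 x).val = if x.val = i.val then i.val + 1 else if x.val = i.val + 1 then i.val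
      else if 2 * k - (x.val + 1) = i.val then 2 * k - (i.val + 1 + 1)
      else if 2 * k - (x.val + 1) = i.val + 1 then 2 * k - (i.val + 1)
      else 2 * k - (x.val + 1) := by
  simp only [generator, apply_ite Fin.val, Fin.val_rev]

theorem flip_generator {k : ℕ} (i : Fin (k - 1)) : flip (generator i) = generator i := by
  refine Subtype.ext (funext fun x => Fin.ext ?_)
  have hi := i.2
  have hx := x.2
  rw [flip_apply, Fin.val_rev, generator_val, generator_val, Fin.val_rev]
  generalize x.val = x at *
  generalize i.val = i at *
  split_ifs <;> omega

theorem generator_top {k : ℕ} (i : Fin (k - 1)) :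
    ∃ x : Fin (2 * k), x.val < k ∧ ((generator i).1 x).val < k := by
  have := i.2
  refine ⟨⟨i.val, by omega⟩, by simp only; omega, ?_⟩
  rw [generator_val, if_pos rfl]
  omega

theorem generator_bottom {k : ℕ} (i : Fin (k - 1)) :
    ∃ x : Fin (2 * k), k ≤ x.val ∧ k ≤ ((generator i).1 x).val := by
  have := i.2
  refine ⟨Fin.rev ⟨i.val, by omega⟩, by rw [Fin.val_rev]; simp only; omega, ?_⟩
  rw [generator_val, Fin.val_rev, if_neg (by simp only; omega), if_neg (by simp only; omega),
    if_pos (by simp only; omega)]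
  omega

/-! ### Stacking with turn-backs, with the identity and with generators. -/

section stack

variable {k : ℕ} {p q : NC2 k}

theorem stack_of_bottom {i : Fin (2 * k)} (hi : k ≤ i.val) (hpi : k ≤ (p.1 i).val) :
    (stack p q).1 i = p.1 i := by
  rw [stack_spec _ _ _ _ (p.2.2.1 i).symm, outer_of_le hi, outer_of_le hpi]
  exact Quot.sound rfl

theorem stack_of_top {i : Fin (2 * k)} (hi : i.val < k) (hqi : (q.1 i).val < k) :
    (stack p q).1 i = q.1 i := by
  rw [stack_spec _ _ _ _ (q.2.2.1 i).symm, outer_of_lt hi, outer_of_lt hqi]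
  exact Quot.sound rfl

/-- A pair on the top of `q` is a pair on the bottom of `flip q`, and it survives at the bottom of
anything stacked on it. -/
theorem stack_flip_ne_rainbow {t : NC2 k} {i : Fin (2 * k)} (hi : i.val < k)
    (hqi : (q.1 i).val < k) : stack (flip q) t ≠ rainbow k := by
  intro h
  have h1 : k ≤ i.rev.val := le_rev_iff.2 hi
  have h2 : (flip q).1 i.rev = (q.1 i).rev := by simp [flip_apply]
  have h3 := stack_of_bottom (q := t) h1 (by rw [h2]; exact le_rev_iff.2 hqi)
  rw [h, rainbow_apply, h2, Fin.rev_rev] at h3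
  rw [h3] at hi
  exact absurd (le_rev_iff.2 hqi) (not_le.2 hi)

theorem stack_flip_ne_rainbow' {t : NC2 k} {i : Fin (2 * k)} (hi : k ≤ i.val)
    (hqi : k ≤ (q.1 i).val) : stack t (flip q) ≠ rainbow k := by
  intro h
  have h1 : i.rev.val < k := rev_lt_iff.2 hi
  have h2 : (flip q).1 i.rev = (q.1 i).rev := by simp [flip_apply]
  have h3 := stack_of_top (p := t) h1 (by rw [h2]; exact rev_lt_iff.2 hqi)
  rw [h, rainbow_apply, h2, Fin.rev_rev] at h3
  rw [h3] at hi
  exact absurd (rev_lt_iff.2 hqi) (not_lt.2 hi)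

/-- If the strands of `p` are vertical or parallel to strands at the bottom of `q`, then stacking
`q` on top of `p` gives `q` again. -/
theorem stack_eq_right
    (htop : ∀ x : Fin (2 * k), x.val < k →
      p.1 x = x.rev ∨ ((p.1 x).val < k ∧ q.1 x.rev = (p.1 x).rev))
    (hbot : ∀ x : Fin (2 * k), k ≤ x.val → p.1 x = x.rev ∨ (k ≤ (p.1 x).val ∧ q.1 x = p.1 x)) :
    stack p q = q := by
  have glue : ∀ x : Fin (2 * k), k ≤ x.val →
      Quot.mk (stackRel p q) (Sum.inl x) = Quot.mk _ (Sum.inr x.rev) := fun x hx =>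
    Quot.sound ⟨rev_lt_iff.2 hx, by simp⟩
  have strand : ∀ x, Quot.mk (stackRel p q) (Sum.inr x) = Quot.mk _ (Sum.inr (p.1 x)) :=
    fun x => Quot.sound rfl
  have outl : ∀ x : Fin (2 * k), (k ≤ (p.1 x).val → k ≤ x.val → p.1 x = x.rev) →
      Quot.mk (stackRel p q) (outer k x) = Quot.mk _ (Sum.inl x) := by
    intro x hx
    rcases lt_or_ge x.val k with h | h
    · rw [outer_of_lt h]
    · rcases hbot x h with h' | h'
      · rw [outer_of_le h, strand, h', glue x h]
      · rw [outer_of_le h, strand, hx h'.1 h, glue x h]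
  -- An outer point is connected to its namesake in `q`, except at the ends of bottom turn-backs of
  -- `p`; those are strands of `q` by `hbot`.
  have conn : ∀ x : Fin (2 * k),
      Quot.mk (stackRel p q) (outer k x) = Quot.mk _ (outer k (q.1 x)) := by
    have side : ∀ x : Fin (2 * k), k ≤ (p.1 x).val → k ≤ x.val → p.1 x ≠ x.rev →
        Quot.mk (stackRel p q) (outer k x) = Quot.mk _ (outer k (q.1 x)) := by
      intro x h1 h2 h3
      have h4 := (hbot x h2).resolve_left h3
      rw [h4.2, outer_of_le h2, outer_of_le h4.1, strand]
    intro x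
    by_cases hx : k ≤ (p.1 x).val → k ≤ x.val → p.1 x = x.rev
    · by_cases hy : k ≤ (p.1 (q.1 x)).val → k ≤ (q.1 x).val → p.1 (q.1 x) = (q.1 x).rev
      · rw [outl x hx, outl _ hy]
        exact Quot.sound rfl
      · push Not at hy
        have := side (q.1 x) hy.1 hy.2.1 hy.2.2
        rw [q.2.1] at this
        exact this.symm
    · push Not at hx
      exact side x hx.1 hx.2.1 hx.2.2
  -- Conversely, the picture collapses onto the strands of `q`, so no further outer points are
  -- connected.
  let F : Fin (2 * k) ⊕ Fin (2 * k) → Quot fun x y => y = q.1 x :=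
    Sum.elim (Quot.mk _) fun x => Quot.mk _ (if x.val < k then x.rev else x)
  have hF : ∀ x y, stackRel p q x y → F x = F y := by
    rintro (x | x) (y | y) h <;> simp only [stackRel] at h
    · exact Quot.sound h
    · simp only [F, Sum.elim_inl, Sum.elim_inr, if_pos h.1, h.2]
    · simp only [F, Sum.elim_inr, h]
      rcases lt_or_ge x.val k with hx | hx
      · rcases htop x hx with h' | h'
        · rw [h', if_pos hx, if_neg (not_lt.2 (le_rev_iff.2 hx))]
        · rw [if_pos hx, if_pos h'.1]
          exact Quot.sound h'.2.symm
      · rcases hbot x hx with h' | h'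
        · rw [h', if_neg (not_lt.2 hx), if_pos (rev_lt_iff.2 hx), Fin.rev_rev]
        · rw [if_neg (not_lt.2 hx), if_neg (not_lt.2 h'.1)]
          exact Quot.sound h'.2.symm
  have hFo : ∀ x, F (outer k x) = Quot.mk _ x := by
    intro x
    rcases lt_or_ge x.val k with h | h
    · rw [outer_of_lt h]; rfl
    · rw [outer_of_le h]
      simp only [F, Sum.elim_inr, if_neg (not_lt.2 h)]
  refine (existsUnique_stack p q).unique (fun i j hij => stack_spec p q i j hij) fun i j hij => ?_
  constructor
  · rintro rfl
    exact conn i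
  · intro h
    have := congrArg (Quot.lift F hF) h
    change F _ = F _ at this
    rw [hFo, hFo, quot_mk_involution q.2.1] at this
    exact this.resolve_left hij

theorem stack_rainbow (q : NC2 k) : stack (rainbow k) q = q :=
  stack_eq_right (fun x _ => Or.inl (rainbow_apply x)) fun x _ => Or.inl (rainbow_apply x)

theorem stackLoops_rainbow (q : NC2 k) : stackLoops (rainbow k) q = 0 := by
  have hr : ∀ x : Fin (2 * k), k ≤ x.val →
      Quot.mk (stackRel (rainbow k) q) (Sum.inr x) = Quot.mk _ (Sum.inr x.rev) := fun x _ =>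
    Quot.sound (rainbow_apply x).symm
  have hg : ∀ x : Fin (2 * k), k ≤ x.val →
      Quot.mk (stackRel (rainbow k) q) (Sum.inl x) = Quot.mk _ (Sum.inr x.rev) := fun x hx =>
    Quot.sound ⟨rev_lt_iff.2 hx, by simp⟩
  rw [stackLoops, Nat.card_eq_zero]
  left
  refine ⟨fun ⟨c, hc⟩ => ?_⟩
  obtain ⟨x | x, rfl⟩ := Quot.exists_rep c
  · refine hc x ?_
    rcases lt_or_ge x.val k with h | h
    · rw [outer_of_lt h]
    · rw [outer_of_le h, hr x h, hg x h]
  · rcases lt_or_ge x.val k with h | h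
    · refine hc x.rev ?_
      rw [outer_of_le (le_rev_iff.2 h), hr _ (le_rev_iff.2 h), Fin.rev_rev]
    · refine hc x ?_
      rw [outer_of_le h]

theorem exists_generator (hq : q ≠ rainbow k) :
    ∃ i : Fin (k - 1), stack (generator i) q = q := by
  obtain ⟨a, h1, h2, h3⟩ := exists_bottom_cup hq
  have h4 : partner q (a + 1) = a := by rw [← h3, partner_partner]
  have qa : ∀ x : Fin (2 * k), x.val = a → (q.1 x).val = a + 1 := fun x hx => by
    rw [← partner_val, hx, h3]
  have qb : ∀ x : Fin (2 * k), x.val = a + 1 → (q.1 x).val = a := fun x hx => by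
    rw [← partner_val, hx, h4]
  -- The generator whose bottom pair consists of the points `a` and `a + 1`; its top pair then meets
  -- the same pair of `q`.
  let i : Fin (k - 1) := ⟨2 * k - 2 - a, by omega⟩
  have hi : i.val = 2 * k - 2 - a := rfl
  refine ⟨i, stack_eq_right (fun x hx => ?_) fun x hx => ?_⟩
  · by_cases e1 : x.val = i.val
    · right
      have := qb x.rev (by rw [Fin.val_rev]; omega)
      simp only [Fin.ext_iff, Fin.val_rev, generator_val, this]
      rw [if_pos e1]
      omega
    by_cases e2 : x.val = i.val + 1
    · right
      have := qa x.rev (by rw [Fin.val_rev]; omega)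
      simp only [Fin.ext_iff, Fin.val_rev, generator_val, this]
      rw [if_neg e1, if_pos e2]
      omega
    · left
      simp only [Fin.ext_iff, Fin.val_rev, generator_val]
      rw [if_neg e1, if_neg e2, if_neg (by omega), if_neg (by omega)]
  · by_cases e1 : x.val = a
    · right
      simp only [Fin.ext_iff, generator_val, qa x e1]
      rw [if_neg (by omega), if_neg (by omega), if_neg (by omega), if_pos (by omega)]
      omega
    by_cases e2 : x.val = a + 1
    · right
      simp only [Fin.ext_iff, generator_val, qb x e2]
      rw [if_neg (by omega), if_neg (by omega), if_pos (by omega)]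
      omega
    · left
      simp only [Fin.ext_iff, Fin.val_rev, generator_val]
      rw [if_neg (by omega), if_neg (by omega), if_neg (by omega), if_neg (by omega)]

end stack

/-! ### Jones-Wenzl projections -/

section JonesWenzl

variable {k : ℕ} {d : ℂ}

theorem rainbow_mul (x : TL k d) : diagramBasis k d (rainbow k) * x = x := by
  have h : mulMap k d (diagramBasis k d (rainbow k)) = LinearMap.id := by
    refine (diagramBasis k d).ext fun q => ?_
    change diagramBasis k d (rainbow k) * diagramBasis k d q = diagramBasis k d q
    rw [diagram_mul, stackLoops_rainbow, stack_rainbow, pow_zero, one_smul]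
  exact LinearMap.congr_fun h x

theorem mul_eq_sum (x y : TL k d) :
    x * y = ∑ q, coeff x q • (diagramBasis k d q * y) := by
  change mulMap k d x y = ∑ q, coeff x q • mulMap k d (diagramBasis k d q) y
  conv_lhs => rw [← (diagramBasis k d).sum_repr x]
  rw [map_sum, LinearMap.sum_apply]
  exact Finset.sum_congr rfl fun q _ => by rw [map_smul, LinearMap.smul_apply]; rfl

theorem TL.smul_mul_smul (a b : ℂ) (x y : TL k d) : (a • x) * (b • y) = (a * b) • (x * y) := by
  change mulMap k d (a • x) (b • y) = (a * b) • mulMap k d x y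
  rw [map_smul (mulMap k d), LinearMap.smul_apply, map_smul, smul_smul]

/-- The dual of the identity is orthogonal to every other diagram. By adjointness, multiplying it by
a diagram that has a turn-back on the glued side gives a vector orthogonal to all diagrams, hence 0.
In x * x only the identity term survives, and its coefficient was scaled to 1. -/
theorem jonesWenzlFull_of_Wg_ne_zero (hk : 1 ≤ k) (h : (form k d).Nondegenerate)
    (hW : ∀ q, Wg h (rainbow k) q ≠ 0) : JonesWenzlFull k d := by
  have hd := ne_zero_of_nondegenerate hk h
  set w := Wg h (rainbow k) (rainbow k) with hw
  have hw0 : w ≠ 0 := hW _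
  let x : TL k d := w⁻¹ • dualDiagram h (rainbow k)
  have hx : ∀ t, form k d (diagramBasis k d t) x = if t = rainbow k then w⁻¹ else 0 := by
    intro t
    simp only [x, map_smul, dualDiagram,
      LinearMap.BilinForm.apply_dualBasis_right h (form_isSymm k d), smul_eq_mul, mul_ite, mul_one,
      mul_zero]
  have hc : ∀ q, coeff x q = w⁻¹ * Wg h (rainbow k) q := by
    intro q
    simp only [x, coeff, Wg, map_smul, Finsupp.smul_apply, smul_eq_mul]
  have hc1 : coeff x (rainbow k) = 1 := by rw [hc, ← hw, inv_mul_cancel₀ hw0]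
  have left : ∀ q : NC2 k, (∃ i : Fin (2 * k), i.val < k ∧ (q.1 i).val < k) →
      diagramBasis k d q * x = 0 := by
    rintro q ⟨i, h1, h2⟩
    refine eq_of_form_diagram h fun t => ?_
    rw [form_diagram_mul, hx, if_neg (stack_flip_ne_rainbow h1 h2), mul_zero, map_zero]
  have right : ∀ q : NC2 k, (∃ i : Fin (2 * k), k ≤ i.val ∧ k ≤ (q.1 i).val) →
      x * diagramBasis k d q = 0 := by
    rintro q ⟨i, h1, h2⟩
    refine eq_of_form_diagram h fun t => ?_
    rw [form_mul_diagram, hx, if_neg (stack_flip_ne_rainbow' h1 h2), mul_zero, map_zero]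
  have hxx : x * x = x := by
    rw [mul_eq_sum, Finset.sum_eq_single (rainbow k), hc1, one_smul, rainbow_mul]
    · intro q _ hq
      rw [left q (exists_top_pair hq), smul_zero]
    · intro hn
      exact absurd (Finset.mem_univ _) hn
  have hx0 : x ≠ 0 := by
    intro h0
    rw [h0] at hc1
    simp [coeff] at hc1
  refine ⟨x, ⟨hx0, hxx, fun i => ⟨left _ (generator_top i), right _ (generator_bottom i)⟩⟩, ?_, ?_⟩
  · rintro y ⟨hy0, hyy, hy⟩
    -- A diagram `t` other than the identity absorbs some generator, so `y` is orthogonal to it up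
    -- to a power of `d`, which is non-zero. Thus `y` is a multiple of `x`, and idempotency fixes
    -- the scalar.
    have hyx : y = (w * form k d (diagramBasis k d (rainbow k)) y) • x := by
      refine eq_of_form_diagram h fun t => ?_
      rw [map_smul, hx, smul_eq_mul]
      by_cases ht : t = rainbow k
      · rw [if_pos ht, ht]
        field_simp
      · rw [if_neg ht, mul_zero]
        obtain ⟨i, hi⟩ := exists_generator ht
        have := form_diagram_mul t (generator i) y
        rw [(hy i).1, map_zero, flip_generator, hi] at this
        exact (mul_eq_zero.1 this.symm).resolve_left (pow_ne_zero _ hd)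
    generalize w * form k d (diagramBasis k d (rainbow k)) y = c at hyx
    rw [hyx, TL.smul_mul_smul, hxx] at hyy
    have hc0 : c ≠ 0 := by
      rintro rfl
      exact hy0 (by rw [hyx, zero_smul])
    have hcc : c * c = c := smul_left_injective ℂ hx0 hyy
    rw [hyx, mul_right_cancel₀ hc0 (hcc.trans (one_mul c).symm), one_smul]
  · intro q
    rw [hc]
    exact mul_ne_zero (inv_ne_zero hw0) (hW q)

end JonesWenzl

/-! ### The Weingarten matrix as the inverse of the Gram matrix -/

/-- The matrix of the bilinear form in the basis of diagrams. -/
noncomputable def formMatrix (k : ℕ) (d : ℂ) : Matrix (NC2 k) (NC2 k) ℂ :=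
  Matrix.of fun p q => d ^ loops p q

theorem nondegenerate_iff_det_formMatrix {k : ℕ} {d : ℂ} :
    (form k d).Nondegenerate ↔ (formMatrix k d).det ≠ 0 := by
  rw [LinearMap.BilinForm.nondegenerate_iff_det_ne_zero (diagramBasis k d)]
  have e : LinearMap.BilinForm.toMatrix (diagramBasis k d) (form k d) = formMatrix k d := by
    ext p q
    rw [LinearMap.BilinForm.toMatrix_apply, form_diagram]
    rfl
  rw [e]

theorem Wg_eq_inv {k : ℕ} {d : ℂ} (h : (form k d).Nondegenerate) (p q : NC2 k) :
    Wg h p q = (formMatrix k d)⁻¹ p q := by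
  have e : Matrix.of (Wg h) * formMatrix k d = 1 := by
    ext p r
    have h1 : form k d (dualDiagram h p) (diagramBasis k d r) = if r = p then 1 else 0 :=
      LinearMap.BilinForm.apply_dualBasis_left h _ p r
    rw [← (diagramBasis k d).sum_repr (dualDiagram h p), map_sum, LinearMap.sum_apply] at h1
    rw [Matrix.mul_apply, Matrix.one_apply]
    simp only [eq_comm (a := p)]
    rw [← h1]
    refine Finset.sum_congr rfl fun q _ => ?_
    rw [map_smul, LinearMap.smul_apply, form_diagram]
    rfl
  rw [Matrix.inv_eq_left_inv e]
  rfl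

/-- The bilinear form is non-degenerate, and all coefficients of the dual basis are non-zero. -/
def WgFull (k : ℕ) (d : ℂ) : Prop :=
  ∃ h : (form k d).Nondegenerate, ∀ p q : NC2 k, Wg h p q ≠ 0

theorem WgFull.jonesWenzlFull {k : ℕ} {d : ℂ} (hk : 1 ≤ k) (h : WgFull k d) :
    JonesWenzlFull k d :=
  jonesWenzlFull_of_Wg_ne_zero hk h.choose (h.choose_spec _)

theorem wgFull_iff {k : ℕ} {d : ℂ} : WgFull k d ↔
    (formMatrix k d).det ≠ 0 ∧ ∀ p q, (formMatrix k d).adjugate p q ≠ 0 := by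
  have key : ∀ p q, (formMatrix k d)⁻¹ p q =
      ((formMatrix k d).det)⁻¹ * (formMatrix k d).adjugate p q := by
    intro p q
    rw [Matrix.inv_def, Ring.inverse_eq_inv']
    rfl
  constructor
  · rintro ⟨h, hW⟩
    refine ⟨nondegenerate_iff_det_formMatrix.1 h, fun p q => ?_⟩
    have := hW p q
    rw [Wg_eq_inv, key] at this
    exact right_ne_zero_of_mul this
  · rintro ⟨h, hW⟩
    refine ⟨nondegenerate_iff_det_formMatrix.2 h, fun p q => ?_⟩
    rw [Wg_eq_inv, key]
    exact mul_ne_zero (inv_ne_zero h) (hW p q)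

/-! ### Real loop parameters -/

/-- Conjugation by a diagonal matrix of signs, with a global sign, changes entries of the inverse
only by signs and so preserves their non-vanishing. -/
theorem wgFull_of_formMatrix_eq {k : ℕ} {d : ℂ} {δ : ℝ} (u : NC2 k → ℝ) (c : ℝ)
    (hu : ∀ p, u p * u p = 1) (hc : c * c = 1)
    (hd : ∀ p q, formMatrix k d p q = ((u p * u q * c * gram k δ p q : ℝ) : ℂ))
    (hδ : 2 * Real.cos (Real.pi / (k + 1)) < δ) : WgFull k d := by
  obtain ⟨h1, h2⟩ := inv_gram_pos_of_lt hδ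
  let V : Matrix (NC2 k) (NC2 k) ℂ :=
    Matrix.of fun p q => ((u p * u q * c * (gram k δ)⁻¹ p q : ℝ) : ℂ)
  have hV : formMatrix k d * V = 1 := by
    ext p r
    have e := congrFun (congrFun (Matrix.mul_nonsing_inv _ h1) p) r
    rw [Matrix.mul_apply] at e
    rw [Matrix.mul_apply]
    have e2 : ∀ q, formMatrix k d p q * V q r =
        ((u p * u r * (gram k δ p q * (gram k δ)⁻¹ q r) : ℝ) : ℂ) := by
      intro q
      rw [hd]
      simp only [V, Matrix.of_apply]
      rw [← Complex.ofReal_mul]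
      congr 1
      linear_combination (u p * u r * gram k δ p q * (gram k δ)⁻¹ q r) *
        (c * c * hu q + hc)
    simp only [e2]
    rw [← Complex.ofReal_sum, ← Finset.mul_sum, e, Matrix.one_apply, Matrix.one_apply]
    split_ifs with hpr
    · rw [hpr, mul_one, hu, Complex.ofReal_one]
    · rw [mul_zero, Complex.ofReal_zero]
  have hu0 : ∀ p, u p ≠ 0 := fun p h => by simpa [h] using hu p
  have hc0 : c ≠ 0 := fun h => by simp [h] at hc
  refine ⟨nondegenerate_iff_det_formMatrix.2 (Matrix.isUnit_det_of_right_inverse hV).ne_zero,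
    fun p q => ?_⟩
  rw [Wg_eq_inv, Matrix.inv_eq_right_inv hV]
  simp only [V, Matrix.of_apply, Ne, Complex.ofReal_eq_zero]
  exact mul_ne_zero (mul_ne_zero (mul_ne_zero (hu0 p) (hu0 q)) hc0) (h2 p q).ne'

theorem neg_one_pow_mul_self (k : ℕ) : (-1 : ℝ) ^ k * (-1) ^ k = 1 := by
  rw [← mul_pow]; simp

theorem wgFull_of_neg {k : ℕ} {δ : ℝ} (hδ : 2 * Real.cos (Real.pi / (k + 1)) < δ) :
    WgFull k ((-δ : ℝ) : ℂ) := by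
  refine wgFull_of_formMatrix_eq (fun _ => 1) ((-1) ^ k) (fun _ => one_mul 1)
    (neg_one_pow_mul_self k) (fun p q => ?_) hδ
  simp only [formMatrix, gram, Matrix.of_apply, one_mul]
  rw [← mul_assoc, neg_one_pow_mul_self, one_mul, Complex.ofReal_pow]

theorem wgFull_of_pos {k : ℕ} {δ : ℝ} (hδ : 2 * Real.cos (Real.pi / (k + 1)) < δ) :
    WgFull k (δ : ℂ) := by
  refine wgFull_of_formMatrix_eq (fun p => (sign p : ℝ)) 1
    (fun p => by exact_mod_cast sign_sq p) (one_mul 1) (fun p q => ?_) hδ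
  have h : (-1 : ℝ) ^ (k + loops p q) = sign p * sign q := by
    exact_mod_cast neg_one_pow_loops p q
  simp only [formMatrix, gram, Matrix.of_apply]
  rw [← h, neg_pow δ, ← Complex.ofReal_pow]
  congr 1
  rw [pow_add]
  linear_combination -δ ^ loops p q * (neg_one_pow_mul_self (loops p q) *
    ((-1) ^ k * (-1) ^ k) + neg_one_pow_mul_self k)

theorem wgFull_of_real {k : ℕ} {d : ℝ}
    (hd : d ∉ Set.Icc (-(2 * Real.cos (Real.pi / (k + 1)))) (2 * Real.cos (Real.pi / (k + 1)))) :
    WgFull k (d : ℂ) := by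
  rw [Set.mem_Icc, not_and_or, not_le, not_le] at hd
  rcases hd with h | h
  · have := wgFull_of_neg (k := k) (δ := -d) (by linarith)
    rwa [neg_neg] at this
  · exact wgFull_of_pos h

/-! ### Almost all loop parameters -/

open Polynomial in
-- By Cramer's rule all conditions say that one polynomial in `d`, the determinant times all
-- cofactors, does not vanish.
theorem finite_not_wgFull (k : ℕ) : {d : ℂ | ¬ WgFull k d}.Finite := by
  let M : Matrix (NC2 k) (NC2 k) ℂ[X] := Matrix.of fun p q => X ^ loops p q
  have hM : ∀ d, (evalRingHom d).mapMatrix M = formMatrix k d := by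
    intro d
    ext p q
    simp [M, formMatrix]
  let P : ℂ[X] := M.det * ∏ p, ∏ q, M.adjugate p q
  have hP : ∀ d, P.eval d = (formMatrix k d).det * ∏ p, ∏ q, (formMatrix k d).adjugate p q := by
    intro d
    have h1 : M.det.eval d = (formMatrix k d).det := by
      rw [← hM, ← RingHom.map_det]; rfl
    have h2 : ∀ p q, (M.adjugate p q).eval d = (formMatrix k d).adjugate p q := by
      intro p q
      rw [← hM, ← RingHom.map_adjugate]; rfl
    simp only [P, eval_mul, eval_prod, h1, h2]
  have hPW : ∀ d, P.eval d ≠ 0 ↔ WgFull k d := by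
    intro d
    rw [hP, wgFull_iff, mul_ne_zero_iff, Finset.prod_ne_zero_iff]
    simp only [Finset.prod_ne_zero_iff, Finset.mem_univ, true_imp_iff]
  have hP0 : P ≠ 0 := by
    intro h0
    -- Any real number above 2 exceeds the threshold for every `k`.
    have h3 : WgFull k ((3 : ℝ) : ℂ) := wgFull_of_pos (by
      linarith [Real.cos_le_one (Real.pi / (k + 1))])
    rw [← hPW, h0] at h3
    simp at h3
  refine (finite_setOfPred_isRoot hP0).subset fun d hd => ?_
  by_contra hc
  exact hd ((hPW d).1 hc)

end TemperleyLieb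

theorem theorem4 (k : ℕ) (hk : 1 ≤ k) :
    -- the dual basis exists for all but finitely many `d`, and each of its diagram coefficients
    -- vanishes for at most finitely many `d`
    ({d : ℂ | ¬ (TemperleyLieb.form k d).Nondegenerate}.Finite ∧
      (∀ p q : TemperleyLieb.NC2 k,
        {d : ℂ | ∃ h : (TemperleyLieb.form k d).Nondegenerate,
          TemperleyLieb.Wg h p q = 0}.Finite) ∧
      {d : ℂ | ¬ TemperleyLieb.JonesWenzlFull k d}.Finite) ∧
    -- real loop parameters outside the interval
    (∀ d : ℝ,
      d ∉ Set.Icc (-(2 * Real.cos (Real.pi / (k + 1)))) (2 * Real.cos (Real.pi / (k + 1))) →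
      (∃ h : (TemperleyLieb.form k (d : ℂ)).Nondegenerate,
        ∀ p q : TemperleyLieb.NC2 k, TemperleyLieb.Wg h p q ≠ 0) ∧
      TemperleyLieb.JonesWenzlFull k (d : ℂ)) ∧
    -- complex loop parameters of large absolute value
    (∃ R : ℝ, ∀ d : ℂ, R < ‖d‖ →
      (∃ h : (TemperleyLieb.form k d).Nondegenerate,
        ∀ p q : TemperleyLieb.NC2 k, TemperleyLieb.Wg h p q ≠ 0) ∧
      TemperleyLieb.JonesWenzlFull k d) := by
  have hfin := TemperleyLieb.finite_not_wgFull k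
  refine ⟨⟨hfin.subset fun d hd h => hd h.choose, fun p q => hfin.subset ?_,
    hfin.subset fun d hd h => hd (h.jonesWenzlFull hk)⟩, fun d hd => ?_, ?_⟩
  · rintro d ⟨h, hW⟩ ⟨_, h'⟩
    exact h' p q hW
  · have h := TemperleyLieb.wgFull_of_real hd
    exact ⟨h, h.jonesWenzlFull hk⟩
  -- `R` bounds the norms of the finitely many exceptional parameters.
  · obtain ⟨R, hR⟩ := hfin.isBounded.exists_norm_le
    refine ⟨R, fun d hd => ?_⟩
    have h : TemperleyLieb.WgFull k d := by
      by_contra hc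
      exact absurd (hR d hc) (not_le.2 hd)
    exact ⟨h, h.jonesWenzlFull hk⟩
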